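/- Let $H^D$ be the operator in $L^2(\mathbb{R})$ (identified with $L^2(\mathbb{R}\setminus\{0\})$) given by $$H^D\psi := -\psi'' + i\,\mathrm{sgn}(x)\,\psi, \qquad \mathsf{Dom}(H^D) := \big(W^{2,2}\cap W^{1,2}_0\big)(\mathbb{R}\setminus\{0\}),$$ where derivatives are weak derivatives in $\mathbb{R}\setminus\{0\}$; that is, $H^D$ is the direct sum of the Dirichlet realisations of $-\frac{d^2}{dx^2}\pm i$ in $L^2(\mathbb{R}_\pm)$. It is associated with the sesquilinear form $$h(\psi,\phi) := \int_{\mathbb{R}}\psi'\,\overline{\phi'}\,dx + i\int_0^{+\infty}\psi\,\overline{\phi}\,dx - i\int_{-\infty}^0\psi\,\overline{\phi}\,dx, \qquad \mathsf{Dom}(h) := W^{1,2}_0(\mathbb{R}\setminus\{0\}).$$ For a complex-valued $V\in L^1(\mathbb{R})$ and $\varepsilon\in\mathbb{R}$, let $H^D_\varepsilon := H^D \,\dot{+}\, \varepsilon V$ be the form sum, i.e. the operator associated with the form $h_\varepsilon := h+\varepsilon v$, where $v(\psi,\phi):=\int_{\mathbb{R}} V\psi\,\overline{\phi}\,dx$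 with $\mathsf{Dom}(v):=\{\psi\in L^2(\mathbb{R}) : |V|^{1/2}\psi\in L^2(\mathbb{R})\}$: its domain consists of all $\psi\in\mathsf{Dom}(h_\varepsilon)$ for which there is an $\eta\in L^2(\mathbb{R})$ with $h_\varepsilon(\psi,\phi)=(\eta,\phi)_{L^2}$ for all $\phi\in\mathsf{Dom}(h_\varepsilon)$, and $H^D_\varepsilon\psi:=\eta$. Suppose that $V\in L^1\big(\mathbb{R},(1+x^2)\,dx\big)$. Then there exists $\varepsilon_0>0$ such that, for all $\varepsilon\in(0,\varepsilon_0)$, $$\sigma(H^D_\varepsilon)=\sigma(H^D)=[0,+\infty)+i\,\{-1,1\}.$$ -/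

import Mathlib

open MeasureTheory
open scoped ContDiff ComplexConjugate InnerProductSpace

noncomputable section

/-! ### Unbounded operators: spectrum, sesquilinear forms, associated operators -/

section Abstract

variable {H : Type*} [NormedAddCommGroup H] [InnerProductSpace ℂ H]

/-- The resolvent set of an unbounded operator `T` in `H`: all `z` for which `T - z`, as a map
from the domain of `T` to `H`, has an everywhere defined bounded two-sided inverse. -/
def opResolventSet (T : H →ₗ.[ℂ] H) : Set ℂ :=
  {z | ∃ R : H →L[ℂ] H,
    (∀ f : H, ∃ h : R f ∈ T.domain, T ⟨R f, h⟩ - z • R f = f) ∧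
    ∀ ψ : T.domain, R (T ψ - z • (ψ : H)) = ψ}

/-- The spectrum of an unbounded operator. -/
def opSpectrum (T : H →ₗ.[ℂ] H) : Set ℂ := (opResolventSet T)ᶜ

variable (H) in
/-- A sesquilinear form in `H`, linear in the first and antilinear in the second argument,
with a linear subspace of `H` as its domain. -/
structure SesqForm where
  /-- the domain of the form -/
  dom : Submodule ℂ H
  /-- the values `t(ψ, φ)` -/
  form : dom →ₗ[ℂ] dom →ₗ⋆[ℂ] ℂ

/-- The sum of two forms, on the intersection of their domains. -/
def SesqForm.add (s t : SesqForm H) : SesqForm H where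
  dom := s.dom ⊓ t.dom
  form := LinearMap.mk₂'ₛₗ (RingHom.id ℂ) (starRingEnd ℂ)
    (fun ψ φ => s.form ⟨ψ, ψ.2.1⟩ ⟨φ, φ.2.1⟩ + t.form ⟨ψ, ψ.2.2⟩ ⟨φ, φ.2.2⟩)
    (fun ψ₁ ψ₂ φ => by
      have h1 := LinearMap.map_add₂ s.form ⟨ψ₁, ψ₁.2.1⟩ ⟨ψ₂, ψ₂.2.1⟩ ⟨φ, φ.2.1⟩
      have h2 := LinearMap.map_add₂ t.form ⟨ψ₁, ψ₁.2.2⟩ ⟨ψ₂, ψ₂.2.2⟩ ⟨φ, φ.2.2⟩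
      exact (congrArg₂ (· + ·) h1 h2).trans (add_add_add_comm _ _ _ _))
    (fun c ψ φ => by
      have h1 := LinearMap.map_smulₛₗ₂ s.form c ⟨ψ, ψ.2.1⟩ ⟨φ, φ.2.1⟩
      have h2 := LinearMap.map_smulₛₗ₂ t.form c ⟨ψ, ψ.2.2⟩ ⟨φ, φ.2.2⟩
      exact (congrArg₂ (· + ·) h1 h2).trans (smul_add _ _ _).symm)
    (fun ψ φ₁ φ₂ => by
      have h1 := (s.form ⟨ψ, ψ.2.1⟩).map_add ⟨φ₁, φ₁.2.1⟩ ⟨φ₂, φ₂.2.1⟩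
      have h2 := (t.form ⟨ψ, ψ.2.2⟩).map_add ⟨φ₁, φ₁.2.2⟩ ⟨φ₂, φ₂.2.2⟩
      exact (congrArg₂ (· + ·) h1 h2).trans (add_add_add_comm _ _ _ _))
    (fun c ψ φ => by
      have h1 := (s.form ⟨ψ, ψ.2.1⟩).map_smulₛₗ c ⟨φ, φ.2.1⟩
      have h2 := (t.form ⟨ψ, ψ.2.2⟩).map_smulₛₗ c ⟨φ, φ.2.2⟩
      exact (congrArg₂ (· + ·) h1 h2).trans (smul_add _ _ _).symm)

/-- All pairs `(ψ, η)` such that `ψ` is in the form domain and `t(ψ, φ) = (η, φ)` for all `φ` in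
the form domain. (Mathlib's inner product is antilinear in the *first* argument, so `(η, φ)`
reads `⟪φ, η⟫_ℂ`.) -/
def SesqForm.operatorGraph (t : SesqForm H) : Submodule ℂ (H × H) where
  carrier := {p | ∃ h : p.1 ∈ t.dom, ∀ φ : t.dom, t.form ⟨p.1, h⟩ φ = ⟪(φ : H), p.2⟫_ℂ}
  zero_mem' := ⟨t.dom.zero_mem, fun φ => by
    rw [Prod.snd_zero, inner_zero_right]
    exact LinearMap.map_zero₂ t.form φ⟩
  add_mem' := by
    rintro p q ⟨hp, hp'⟩ ⟨hq, hq'⟩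
    refine ⟨t.dom.add_mem hp hq, fun φ => ?_⟩
    have := LinearMap.map_add₂ t.form ⟨p.1, hp⟩ ⟨q.1, hq⟩ φ
    rw [hp', hq'] at this
    rw [Prod.snd_add, inner_add_right]
    exact this
  smul_mem' := by
    rintro c p ⟨hp, hp'⟩
    refine ⟨t.dom.smul_mem c hp, fun φ => ?_⟩
    have := LinearMap.map_smulₛₗ₂ t.form c ⟨p.1, hp⟩ φ
    rw [hp'] at this
    rw [Prod.smul_snd, inner_smul_right]
    exact this

/-- For a densely defined form, the pairs in `operatorGraph` form the graph of an operator. -/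
theorem SesqForm.operatorGraph_functional (t : SesqForm H) (ht : Dense (t.dom : Set H)) :
    ∀ p ∈ t.operatorGraph, p.1 = 0 → p.2 = 0 := by
  rintro ⟨ψ, η⟩ ⟨h, h'⟩ hψ
  simp only at h h' hψ
  subst hψ
  have hη : ∀ φ ∈ (t.dom : Set H), ⟪φ, η⟫_ℂ = 0 := fun φ hφ => by
    rw [← h' ⟨φ, hφ⟩]
    exact LinearMap.map_zero₂ t.form _
  exact ht.eq_zero_of_inner_right ℂ hη

/-- The operator associated with a (densely defined) form `t` by the representation theorem:
its domain is the set of all `ψ` in the form domain for which there is an `η ∈ H` with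
`t(ψ, φ) = (η, φ)` for all `φ` in the form domain, and it maps `ψ` to this `η`. -/
def SesqForm.operator (t : SesqForm H) : H →ₗ.[ℂ] H := t.operatorGraph.toLinearPMap

end Abstract

/-! ### Sobolev spaces on the punctured line -/

/-- The Hilbert space `L²(ℝ)`; it is identified with `L²(ℝ ∖ {0})`. -/
abbrev L2R : Type := Lp ℂ 2 (volume : Measure ℝ)

/-- `φ ∈ C_c^∞(ℝ ∖ {0})`. -/
def IsTestFun (φ : ℝ → ℂ) : Prop :=
  ContDiff ℝ ∞ φ ∧ HasCompactSupport φ ∧ tsupport φ ⊆ ({0}ᶜ : Set ℝ)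

theorem IsTestFun.deriv {φ : ℝ → ℂ} (h : IsTestFun φ) : IsTestFun (deriv φ) :=
  ⟨(contDiff_infty_iff_deriv.1 h.1).2, h.2.1.deriv,
    (closure_minimal support_deriv_subset (isClosed_tsupport φ)).trans h.2.2⟩

theorem IsTestFun.memLp {φ : ℝ → ℂ} (h : IsTestFun φ) : MemLp φ 2 volume :=
  h.1.continuous.memLp_of_hasCompactSupport h.2.1

theorem IsTestFun.integrable_mul {φ : ℝ → ℂ} (h : IsTestFun φ) (ψ : L2R) :
    Integrable (fun x => ψ x * φ x) volume :=
  (Lp.memLp ψ).integrable_mul h.memLp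

/-- An `L²` function that annihilates all test functions is zero. -/
theorem eq_zero_of_testFun {g : L2R} (h : ∀ φ, IsTestFun φ → ∫ x, g x * φ x = 0) : g = 0 := by
  have h0 : ∀ᵐ x ∂(volume : Measure ℝ), x ∈ ({0}ᶜ : Set ℝ) → g x = 0 := by
    refine IsOpen.ae_eq_zero_of_integral_contDiff_smul_eq_zero isOpen_compl_singleton
      (((Lp.memLp g).locallyIntegrable (by norm_num)).locallyIntegrableOn _) ?_
    intro u hu hc hs
    have hsupp : Function.support (fun x => (u x : ℂ)) = Function.support u := by
      ext x; simp
    have ht : tsupport (fun x => (u x : ℂ)) = tsupport u := by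
      rw [tsupport, hsupp, tsupport]
    have := h (fun x => (u x : ℂ)) ⟨Complex.ofRealCLM.contDiff.comp hu, by
      rwa [HasCompactSupport, ht], by rwa [ht]⟩
    rw [← this]
    congr 1
    ext x
    rw [Complex.real_smul, mul_comm]
  apply Lp.ext
  have h1 : ∀ᵐ x ∂(volume : Measure ℝ), x ∈ ({0}ᶜ : Set ℝ) := by
    rw [ae_iff]; simp
  filter_upwards [h0, h1, Lp.coeFn_zero ℂ 2 (volume : Measure ℝ)] with x hx hx1 hx2
  rw [hx hx1, hx2]; rfl

/-- All pairs `(ψ, g)` in `L² × L²` such that `g` is the weak derivative of `ψ` in `ℝ ∖ {0}`. -/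
def weakDerivGraph : Submodule ℂ (L2R × L2R) where
  carrier := {p | ∀ φ, IsTestFun φ → ∫ x, p.1 x * deriv φ x = -∫ x, p.2 x * φ x}
  zero_mem' := fun φ _ => by
    have h : ∀ u : ℝ → ℂ, ∫ x, (0 : L2R) x * u x = 0 := fun u => by
      rw [← integral_zero ℝ ℂ]
      refine integral_congr_ae ?_
      exact Filter.Eventually.of_forall fun x => by simp
    simp only [Prod.fst_zero, Prod.snd_zero, h, neg_zero]
  add_mem' := by
    intro p q hp hq φ hφ
    have h : ∀ (a b : L2R) (u : ℝ → ℂ), IsTestFun u →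
        ∫ x, (a + b) x * u x = (∫ x, a x * u x) + ∫ x, b x * u x := fun a b u hu => by
      rw [← integral_add (hu.integrable_mul a) (hu.integrable_mul b)]
      refine integral_congr_ae ?_
      filter_upwards [Lp.coeFn_add a b] with x hx
      simp only [hx, Pi.add_apply, add_mul]
    rw [Prod.fst_add, Prod.snd_add, h _ _ _ hφ, h _ _ _ hφ.deriv, hp φ hφ, hq φ hφ, neg_add]
  smul_mem' := by
    intro c p hp φ hφ
    have h : ∀ (a : L2R) (u : ℝ → ℂ), ∫ x, (c • a) x * u x = c * ∫ x, a x * u x := fun a u => by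
      rw [← integral_const_mul]
      refine integral_congr_ae ?_
      filter_upwards [Lp.coeFn_smul c a] with x hx
      simp only [hx, Pi.smul_apply, smul_eq_mul, mul_assoc]
    rw [Prod.smul_fst, Prod.smul_snd, h, h, hp φ hφ, mul_neg]

theorem weakDerivGraph_functional : ∀ p ∈ weakDerivGraph, p.1 = 0 → p.2 = 0 := by
  rintro ⟨ψ, g⟩ h hψ
  simp only at hψ
  subst hψ
  refine eq_zero_of_testFun fun φ hφ => ?_
  have h1 := h φ hφ
  have h2 : ∫ x, (0 : L2R) x * deriv φ x = 0 := by
    rw [← integral_zero ℝ ℂ]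
    refine integral_congr_ae ?_
    exact Filter.Eventually.of_forall fun x => by simp
  simp only [h2] at h1
  exact neg_eq_zero.1 h1.symm

/-- The weak derivative in `ℝ ∖ {0}`, as an operator in `L²`. -/
def weakDeriv : L2R →ₗ.[ℂ] L2R := weakDerivGraph.toLinearPMap

/-- `W^{1,2}(ℝ ∖ {0})`. -/
def W12 : Submodule ℂ L2R := weakDeriv.domain

/-- `W^{2,2}(ℝ ∖ {0})`. -/
def W22 : Submodule ℂ L2R where
  carrier := {ψ | ∃ h : ψ ∈ W12, weakDeriv ⟨ψ, h⟩ ∈ W12}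
  zero_mem' := ⟨W12.zero_mem, by
    have h : weakDeriv ⟨0, W12.zero_mem⟩ = 0 := weakDeriv.map_zero
    rw [h]; exact W12.zero_mem⟩
  add_mem' := by
    rintro a b ⟨ha, ha'⟩ ⟨hb, hb'⟩
    have h : weakDeriv ⟨a + b, W12.add_mem ha hb⟩ = weakDeriv ⟨a, ha⟩ + weakDeriv ⟨b, hb⟩ :=
      weakDeriv.map_add ⟨a, ha⟩ ⟨b, hb⟩
    exact ⟨W12.add_mem ha hb, by rw [h]; exact W12.add_mem ha' hb'⟩
  smul_mem' := by
    rintro c a ⟨ha, ha'⟩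
    have h : weakDeriv ⟨c • a, W12.smul_mem c ha⟩ = c • weakDeriv ⟨a, ha⟩ :=
      weakDeriv.map_smul c ⟨a, ha⟩
    exact ⟨W12.smul_mem c ha, by rw [h]; exact W12.smul_mem c ha'⟩

/-- All pairs `(φ, φ')` in `L² × L²` with `φ ∈ C_c^∞(ℝ ∖ {0})`. -/
def testPairs : Submodule ℂ (L2R × L2R) where
  carrier := {p | ∃ φ, IsTestFun φ ∧ p.1 =ᵐ[volume] φ ∧ p.2 =ᵐ[volume] deriv φ}
  zero_mem' := by
    refine ⟨0, ⟨contDiff_const, HasCompactSupport.zero, by simp⟩,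
      Lp.coeFn_zero ℂ 2 _, ?_⟩
    have h : deriv (0 : ℝ → ℂ) = 0 := by ext x; simp
    rw [h]; exact Lp.coeFn_zero ℂ 2 _
  add_mem' := by
    rintro p q ⟨φ, hφ, h1, h2⟩ ⟨χ, hχ, k1, k2⟩
    refine ⟨φ + χ, ⟨hφ.1.add hχ.1, hφ.2.1.add hχ.2.1,
      (tsupport_add φ χ).trans (Set.union_subset hφ.2.2 hχ.2.2)⟩, ?_, ?_⟩
    · exact (Lp.coeFn_add _ _).trans (h1.add k1)
    · have h : deriv (φ + χ) = deriv φ + deriv χ := by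
        ext x
        exact deriv_add (hφ.1.differentiable (by simp) x) (hχ.1.differentiable (by simp) x)
      rw [h]; exact (Lp.coeFn_add _ _).trans (h2.add k2)
  smul_mem' := by
    rintro c p ⟨φ, hφ, h1, h2⟩
    refine ⟨c • φ, ⟨hφ.1.const_smul c, hφ.2.1.smul_left (f := fun _ => c),
      (closure_mono (Function.support_const_smul_subset c φ)).trans hφ.2.2⟩, ?_, ?_⟩
    · exact (Lp.coeFn_smul _ _).trans (h1.const_smul c)
    · have h : deriv (c • φ) = c • deriv φ := by
        ext x
        exact deriv_const_smul c (hφ.1.differentiable (by simp) x)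
      rw [h]; exact (Lp.coeFn_smul _ _).trans (h2.const_smul c)

/-- `W_0^{1,2}(ℝ ∖ {0})`: the closure of `C_c^∞(ℝ ∖ {0})` in `W^{1,2}(ℝ ∖ {0})`, whose topology
is that of `(ψ, ψ') ∈ L² × L²`. -/
def W12zero : Submodule ℂ L2R where
  carrier := {ψ | ∃ h : ψ ∈ W12, (ψ, weakDeriv ⟨ψ, h⟩) ∈ closure (testPairs : Set (L2R × L2R))}
  zero_mem' := ⟨W12.zero_mem, by
    have h : weakDeriv ⟨0, W12.zero_mem⟩ = 0 := weakDeriv.map_zero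
    rw [h]; exact subset_closure testPairs.zero_mem⟩
  add_mem' := by
    rintro a b ⟨ha, ha'⟩ ⟨hb, hb'⟩
    have h : weakDeriv ⟨a + b, W12.add_mem ha hb⟩ = weakDeriv ⟨a, ha⟩ + weakDeriv ⟨b, hb⟩ :=
      weakDeriv.map_add ⟨a, ha⟩ ⟨b, hb⟩
    refine ⟨W12.add_mem ha hb, ?_⟩
    rw [h]
    exact testPairs.topologicalClosure.add_mem ha' hb'
  smul_mem' := by
    rintro c a ⟨ha, ha'⟩
    have h : weakDeriv ⟨c • a, W12.smul_mem c ha⟩ = c • weakDeriv ⟨a, ha⟩ :=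
      weakDeriv.map_smul c ⟨a, ha⟩
    refine ⟨W12.smul_mem c ha, ?_⟩
    rw [h]
    exact testPairs.topologicalClosure.smul_mem c ha'

/-! ### The Dirichlet operator -/

theorem memLp_sign_mul (ψ : L2R) :
    MemLp (fun x => (Real.sign x : ℂ) * ψ x) 2 (volume : Measure ℝ) := by
  have hm : Measurable Real.sign :=
    Measurable.ite measurableSet_Iio measurable_const
      (Measurable.ite measurableSet_Ioi measurable_const measurable_const)
  refine (Lp.memLp ψ).of_le
    ((Complex.measurable_ofReal.comp hm).aestronglyMeasurable.mul (Lp.aestronglyMeasurable ψ))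
    (Filter.Eventually.of_forall fun x => ?_)
  rw [norm_mul, Complex.norm_real, Real.norm_eq_abs]
  refine mul_le_of_le_one_left (norm_nonneg _) ?_
  rcases Real.sign_apply_eq x with h | h | h <;> simp [h]

/-- Multiplication by `sgn` in `L²(ℝ)`. -/
def signMul : L2R →ₗ[ℂ] L2R where
  toFun ψ := (memLp_sign_mul ψ).toLp _
  map_add' a b := by
    rw [← MemLp.toLp_add, MemLp.toLp_eq_toLp_iff]
    filter_upwards [Lp.coeFn_add a b] with x hx
    simp only [hx, Pi.add_apply, mul_add]
  map_smul' c a := by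
    rw [RingHom.id_apply, ← MemLp.toLp_const_smul, MemLp.toLp_eq_toLp_iff]
    filter_upwards [Lp.coeFn_smul c a] with x hx
    simp only [hx, Pi.smul_apply, smul_eq_mul, mul_left_comm]

/-- The operator `H^D = -d²/dx² + i sgn(x)` in `L²(ℝ)` with the Dirichlet condition at `0`, that
is, with domain `(W^{2,2} ∩ W_0^{1,2})(ℝ ∖ {0})`. -/
def dirichletOp : L2R →ₗ.[ℂ] L2R where
  domain := W22 ⊓ W12zero
  toFun :=
    { toFun := fun ψ =>
        -weakDeriv ⟨weakDeriv ⟨ψ, ψ.2.1.1⟩, ψ.2.1.2⟩ + Complex.I • signMul (ψ : L2R)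
      map_add' := fun a b => by
        have h : weakDeriv ⟨(a + b : L2R), (a + b).2.1.1⟩
            = weakDeriv ⟨a, a.2.1.1⟩ + weakDeriv ⟨b, b.2.1.1⟩ :=
          weakDeriv.map_add ⟨a, a.2.1.1⟩ ⟨b, b.2.1.1⟩
        have h2 : weakDeriv ⟨weakDeriv ⟨(a + b : L2R), (a + b).2.1.1⟩, (a + b).2.1.2⟩
            = weakDeriv ⟨_, a.2.1.2⟩ + weakDeriv ⟨_, b.2.1.2⟩ := by
          rw [← weakDeriv.map_add]
          congr 1
          exact Subtype.ext h
        have h3 : signMul ((a + b : ↥(W22 ⊓ W12zero)) : L2R) = signMul a + signMul b :=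
          signMul.map_add a b
        rw [h3, smul_add]
        refine (congrArg (fun t => -t + (Complex.I • signMul (a : L2R)
          + Complex.I • signMul (b : L2R))) h2).trans ?_
        abel
      map_smul' := fun c a => by
        have h : weakDeriv ⟨(c • a : L2R), (c • a).2.1.1⟩ = c • weakDeriv ⟨a, a.2.1.1⟩ :=
          weakDeriv.map_smul c ⟨a, a.2.1.1⟩
        have h2 : weakDeriv ⟨weakDeriv ⟨(c • a : L2R), (c • a).2.1.1⟩, (c • a).2.1.2⟩
            = c • weakDeriv ⟨_, a.2.1.2⟩ := by
          rw [← weakDeriv.map_smul]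
          congr 1
          exact Subtype.ext h
        have h3 : signMul ((c • a : ↥(W22 ⊓ W12zero)) : L2R) = c • signMul a :=
          signMul.map_smul c a
        rw [h3, RingHom.id_apply, smul_add, smul_neg, smul_comm c Complex.I]
        exact congrArg (fun t => -t + Complex.I • c • signMul (a : L2R)) h2 }

/-! ### The forms -/

theorem integrable_mul_conj (a b : L2R) :
    Integrable (fun x => a x * conj (b x)) (volume : Measure ℝ) :=
  (Lp.memLp a).integrable_mul (Lp.memLp b).star

theorem setIntegral_add_mul_conj (s : Set ℝ) (a b c : L2R) :
    ∫ x in s, (a + b) x * conj (c x)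
      = (∫ x in s, a x * conj (c x)) + ∫ x in s, b x * conj (c x) := by
  rw [← integral_add (integrable_mul_conj a c).integrableOn (integrable_mul_conj b c).integrableOn]
  refine integral_congr_ae (ae_restrict_of_ae ?_)
  filter_upwards [Lp.coeFn_add a b] with x hx
  simp only [hx, Pi.add_apply, add_mul]

theorem setIntegral_mul_conj_add (s : Set ℝ) (a b c : L2R) :
    ∫ x in s, a x * conj ((b + c) x)
      = (∫ x in s, a x * conj (b x)) + ∫ x in s, a x * conj (c x) := by
  rw [← integral_add (integrable_mul_conj a b).integrableOn (integrable_mul_conj a c).integrableOn]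
  refine integral_congr_ae (ae_restrict_of_ae ?_)
  filter_upwards [Lp.coeFn_add b c] with x hx
  simp only [hx, Pi.add_apply, map_add, mul_add]

theorem setIntegral_smul_mul_conj (s : Set ℝ) (k : ℂ) (a c : L2R) :
    ∫ x in s, (k • a) x * conj (c x) = k * ∫ x in s, a x * conj (c x) := by
  rw [← integral_const_mul]
  refine integral_congr_ae (ae_restrict_of_ae ?_)
  filter_upwards [Lp.coeFn_smul k a] with x hx
  simp only [hx, Pi.smul_apply, smul_eq_mul, mul_assoc]

theorem setIntegral_mul_conj_smul (s : Set ℝ) (k : ℂ) (a c : L2R) :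
    ∫ x in s, a x * conj ((k • c) x) = conj k * ∫ x in s, a x * conj (c x) := by
  rw [← integral_const_mul]
  refine integral_congr_ae (ae_restrict_of_ae ?_)
  filter_upwards [Lp.coeFn_smul k c] with x hx
  simp only [hx, Pi.smul_apply, smul_eq_mul, map_mul, mul_left_comm]

/-- The weak derivative of an element of `W_0^{1,2}(ℝ ∖ {0})`. -/
def W12zero.deriv (ψ : W12zero) : L2R := weakDeriv ⟨ψ, ψ.2.1⟩

theorem W12zero.deriv_add (a b : W12zero) :
    W12zero.deriv (a + b) = W12zero.deriv a + W12zero.deriv b :=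
  weakDeriv.map_add ⟨a, a.2.1⟩ ⟨b, b.2.1⟩

theorem W12zero.deriv_smul (c : ℂ) (a : W12zero) :
    W12zero.deriv (c • a) = c • W12zero.deriv a :=
  weakDeriv.map_smul c ⟨a, a.2.1⟩

/-- The sesquilinear form of `H^D`, with domain `W_0^{1,2}(ℝ ∖ {0})`:
`h(ψ, φ) = ∫ ψ' φ̄' dx + i ∫_0^∞ ψ φ̄ dx - i ∫_{-∞}^0 ψ φ̄ dx`. -/
def dirichletForm : SesqForm L2R where
  dom := W12zero
  form := LinearMap.mk₂'ₛₗ (RingHom.id ℂ) (starRingEnd ℂ)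
    (fun ψ φ =>
      (∫ x in Set.univ, W12zero.deriv ψ x * conj (W12zero.deriv φ x))
        + Complex.I * (∫ x in Set.Ioi 0, (ψ : L2R) x * conj ((φ : L2R) x))
        - Complex.I * (∫ x in Set.Iio 0, (ψ : L2R) x * conj ((φ : L2R) x)))
    (fun a b c => by
      simp only [W12zero.deriv_add, Submodule.coe_add, setIntegral_add_mul_conj]; ring)
    (fun k a c => by
      simp only [W12zero.deriv_smul, Submodule.coe_smul, setIntegral_smul_mul_conj,
        RingHom.id_apply, smul_eq_mul]; ring)
    (fun a b c => by
      simp only [W12zero.deriv_add, Submodule.coe_add, setIntegral_mul_conj_add]; ring)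
    (fun k a c => by
      simp only [W12zero.deriv_smul, Submodule.coe_smul, setIntegral_mul_conj_smul,
        smul_eq_mul]; ring)

/-- The potential space `L¹(ℝ)` (complex valued). -/
abbrev L1R : Type := Lp ℂ 1 (volume : Measure ℝ)

/-- The domain `{ψ ∈ L² : |V|^{1/2} ψ ∈ L²}` of the form of a potential. -/
def potentialDom (V : L1R) : Submodule ℂ L2R where
  carrier := {ψ | MemLp (fun x => (√‖V x‖ : ℂ) * ψ x) 2 (volume : Measure ℝ)}
  zero_mem' := by
    refine (MemLp.zero' : MemLp (fun _ : ℝ => (0 : ℂ)) 2 volume).ae_eq ?_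
    exact Filter.Eventually.of_forall fun x => by simp
  add_mem' := by
    intro a b ha hb
    refine (MemLp.add ha hb).ae_eq ?_
    filter_upwards [Lp.coeFn_add a b] with x hx
    simp only [hx, Pi.add_apply, mul_add]
  smul_mem' := by
    intro c a ha
    refine (MemLp.const_smul ha c).ae_eq ?_
    filter_upwards [Lp.coeFn_smul c a] with x hx
    simp only [hx, Pi.smul_apply, smul_eq_mul, mul_left_comm]

theorem integrable_potential (V : L1R) (a b : potentialDom V) :
    Integrable (fun x => V x * (a : L2R) x * conj ((b : L2R) x)) (volume : Measure ℝ) := by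
  refine (MemLp.integrable_mul a.2 b.2.star).mono
    (((Lp.aestronglyMeasurable V).mul (Lp.aestronglyMeasurable _)).mul
      (Lp.aestronglyMeasurable (b : L2R)).star) (Filter.Eventually.of_forall fun x => ?_)
  simp only [Pi.mul_apply, Pi.star_apply, norm_mul, norm_star, Complex.norm_real, Real.norm_eq_abs,
    abs_of_nonneg (Real.sqrt_nonneg _), RCLike.norm_conj]
  refine le_of_eq ?_
  rw [mul_mul_mul_comm, Real.mul_self_sqrt (norm_nonneg (V x)), mul_assoc]

/-- The sesquilinear form `v(ψ, φ) = ∫ V ψ φ̄ dx` of a potential `V ∈ L¹(ℝ)`. -/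
def potentialForm (V : L1R) : SesqForm L2R where
  dom := potentialDom V
  form := LinearMap.mk₂'ₛₗ (RingHom.id ℂ) (starRingEnd ℂ)
    (fun ψ φ => ∫ x, V x * (ψ : L2R) x * conj ((φ : L2R) x))
    (fun a b c => by
      rw [← integral_add (integrable_potential V a c) (integrable_potential V b c)]
      refine integral_congr_ae ?_
      filter_upwards [Lp.coeFn_add (a : L2R) b] with x hx
      simp only [Submodule.coe_add, hx, Pi.add_apply, add_mul, mul_add])
    (fun k a c => by
      rw [RingHom.id_apply, smul_eq_mul, ← integral_const_mul]
      refine integral_congr_ae ?_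
      filter_upwards [Lp.coeFn_smul k (a : L2R)] with x hx
      simp only [Submodule.coe_smul, hx, Pi.smul_apply, smul_eq_mul]; ring)
    (fun a b c => by
      rw [← integral_add (integrable_potential V a b) (integrable_potential V a c)]
      refine integral_congr_ae ?_
      filter_upwards [Lp.coeFn_add (b : L2R) c] with x hx
      simp only [Submodule.coe_add, hx, Pi.add_apply, map_add, mul_add])
    (fun k a c => by
      rw [smul_eq_mul, ← integral_const_mul]
      refine integral_congr_ae ?_
      filter_upwards [Lp.coeFn_smul k (c : L2R)] with x hx
      simp only [Submodule.coe_smul, hx, Pi.smul_apply, smul_eq_mul, map_mul]; ring)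

/-- The form of `H^D ∔ V`: the sum of the form of `H^D` and the form of `V`. -/
def perturbedForm (V : L1R) : SesqForm L2R := dirichletForm.add (potentialForm V)

/-- The operator `H^D ∔ V`, the sum being understood in the sense of forms. -/
def dirichletPerturbed (V : L1R) : L2R →ₗ.[ℂ] L2R := (perturbedForm V).operator

/-! ### The forms above are densely defined -/

theorem IsTestFun.toLp_mem_W12zero {φ : ℝ → ℂ} (h : IsTestFun φ) :
    h.memLp.toLp φ ∈ W12zero := by
  have hg : (h.memLp.toLp φ, h.deriv.memLp.toLp (_root_.deriv φ)) ∈ weakDerivGraph := by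
    intro χ hχ
    have e1 : ∫ x, (h.memLp.toLp φ : L2R) x * _root_.deriv χ x = ∫ x, φ x * _root_.deriv χ x := by
      refine integral_congr_ae ?_
      filter_upwards [h.memLp.coeFn_toLp] with x hx
      rw [hx]
    have e2 : ∫ x, (h.deriv.memLp.toLp (_root_.deriv φ) : L2R) x * χ x
        = ∫ x, _root_.deriv φ x * χ x := by
      refine integral_congr_ae ?_
      filter_upwards [h.deriv.memLp.coeFn_toLp] with x hx
      rw [hx]
    simp only [e1, e2]
    refine integral_mul_deriv_eq_deriv_mul_of_integrable (u := φ) (v := χ)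
      (fun x _ => (h.1.differentiable (by simp) x).hasDerivAt)
      (fun x _ => (hχ.1.differentiable (by simp) x).hasDerivAt)
      (h.memLp.integrable_mul hχ.deriv.memLp) (h.deriv.memLp.integrable_mul hχ.memLp)
      (h.memLp.integrable_mul hχ.memLp)
  have hW : h.memLp.toLp φ ∈ W12 := ⟨_, hg, rfl⟩
  have hD : weakDeriv ⟨_, hW⟩ = h.deriv.memLp.toLp (_root_.deriv φ) := by
    have h1 := Submodule.mem_graph_toLinearPMap weakDerivGraph_functional ⟨_, hW⟩
    have h2 := weakDerivGraph_functional _ (weakDerivGraph.sub_mem h1 hg) (by simp)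
    exact sub_eq_zero.1 h2
  refine ⟨hW, subset_closure ?_⟩
  rw [hD]
  exact ⟨φ, h, h.memLp.coeFn_toLp, h.deriv.memLp.coeFn_toLp⟩

theorem IsTestFun.toLp_mem_potentialDom {φ : ℝ → ℂ} (h : IsTestFun φ) (V : L1R) :
    h.memLp.toLp φ ∈ potentialDom V := by
  obtain ⟨C, hC⟩ := h.1.continuous.bounded_above_of_compact_support h.2.1
  have hs : MemLp (fun x => (√‖V x‖ : ℂ)) 2 (volume : Measure ℝ) := by
    have hm : AEStronglyMeasurable (fun x => (√‖V x‖ : ℂ)) (volume : Measure ℝ) :=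
      (Complex.continuous_ofReal.comp Real.continuous_sqrt).comp_aestronglyMeasurable
        (Lp.aestronglyMeasurable V).norm
    rw [memLp_two_iff_integrable_sq_norm hm]
    refine (L1.integrable_coeFn V).norm.congr (Filter.Eventually.of_forall fun x => ?_)
    simp only [Complex.norm_real, Real.norm_eq_abs, sq_abs, Real.sq_sqrt (norm_nonneg _)]
  refine (hs.const_mul (C : ℂ)).of_le
    (hs.1.mul (Lp.aestronglyMeasurable _)) ?_
  filter_upwards [h.memLp.coeFn_toLp] with x hx
  rw [hx, norm_mul, norm_mul, mul_comm]
  refine mul_le_mul_of_nonneg_right ((hC x).trans ?_) (norm_nonneg _)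
  rw [Complex.norm_real]
  exact le_abs_self C

theorem perturbedForm_dense (V : L1R) : Dense ((perturbedForm V).dom : Set L2R) := by
  rw [Submodule.dense_iff_topologicalClosure_eq_top,
    Submodule.topologicalClosure_eq_top_iff, Submodule.eq_bot_iff]
  intro g hg
  refine eq_zero_of_testFun fun φ hφ => ?_
  have hc : IsTestFun (fun x => conj (φ x)) := by
    have hsupp : Function.support (fun x => conj (φ x)) = Function.support φ := by
      ext x; simp
    have ht : tsupport (fun x => conj (φ x)) = tsupport φ := by
      rw [tsupport, hsupp, tsupport]
    refine ⟨Complex.conjCLE.contDiff.comp hφ.1, ?_, ?_⟩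
    · rw [HasCompactSupport, ht]; exact hφ.2.1
    · rw [ht]; exact hφ.2.2
  have := (Submodule.mem_orthogonal _ _).1 hg _
    (⟨hc.toLp_mem_W12zero, hc.toLp_mem_potentialDom V⟩ :
      hc.memLp.toLp _ ∈ (perturbedForm V).dom)
  rw [L2.inner_def] at this
  rw [← this]
  refine integral_congr_ae ?_
  filter_upwards [hc.memLp.coeFn_toLp] with x hx
  rw [hx]
  simp [RCLike.inner_apply]

end

noncomputable section

/-! ### Inner products and multiplication by the sign -/

/-! The proof rests on a first order factorisation of the form and a Hardy type bound that is
uniform in the spectral parameter.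

For `z` off the two half-lines, let `k` and `l` be the square roots of `z - i` and `z + i` in the
open upper half-plane, and put `α = (k - l)/2`, `β = (k + l)/2`. Then `(α + β sgn)² = z - i sgn`.
Since the boundary values at `0` vanish, integration by parts gives `h(u,v) - z (u,v) = (L u, L' v)`
with `L = d/dx - i(α + β sgn)` and `L' = d/dx + i(conj α + conj β sgn)` (`inner_firstOrder`). Both
factors are isomorphisms of `W_0^{1,2}` onto `L²` (`firstOrderEquiv`).

If `L u = g`, then `u(x)` is the integral of `g` from `0` to `x` against an exponential of modulus
at most one, so `|u(x)|² ≤ |x| ‖L u‖²`, with no constant depending on `z` (`ae_norm_sq_le`). Hence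
the potential form is `(S L u, L' v)` with `‖S‖ ≤ ∫ |x| |W|` (`exists_potentialOp`). When this
integral is less than one, `1 + S` is invertible for every such `z` at once, and no spectrum appears
off the half-lines (`mem_opResolventSet_of_notMem`).

Conversely, for `z = k² ± i` with `k` real, a bounded resolvent is refuted by wave packets `e^{ikx}
ρ(x/s²)` on the matching half-line. Their squared norm grows like `s²`. Evaluated on the packet
itself, the weak resolvent equation bounds this by `P + Q s` (`notMem_opResolventSet_of_mem`). Only
the form is tested on the packets, so they need not lie in the operator domain.

The unperturbed operator is the case `W = 0` (`dirichletOp_eq`). -/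

theorem L2R.inner_eq (u v : L2R) : ⟪u, v⟫_ℂ = ∫ x, v x * conj (u x) := by
  rw [L2.inner_def]; simp only [RCLike.inner_apply]

theorem inner_toLp_left {φ : ℝ → ℂ} (hφ : MemLp φ 2 volume) (u : L2R) :
    ⟪hφ.toLp φ, u⟫_ℂ = ∫ x, u x * conj (φ x) := by
  rw [L2R.inner_eq]
  refine integral_congr_ae ?_
  filter_upwards [hφ.coeFn_toLp] with x hx
  rw [hx]

theorem coeFn_signMul (u : L2R) : signMul u =ᵐ[volume] fun x => (Real.sign x : ℂ) * u x :=
  (memLp_sign_mul u).coeFn_toLp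

theorem ae_ne_zero : ∀ᵐ x ∂(volume : Measure ℝ), x ≠ 0 := by
  rw [ae_iff]; simp

theorem real_sign_mul_self {x : ℝ} (hx : x ≠ 0) : Real.sign x * Real.sign x = 1 := by
  rcases lt_or_gt_of_ne hx with h | h
  · simp [Real.sign_of_neg h]
  · simp [Real.sign_of_pos h]

theorem signMul_signMul (u : L2R) : signMul (signMul u) = u := by
  apply Lp.ext
  filter_upwards [coeFn_signMul u, coeFn_signMul (signMul u), ae_ne_zero] with x h1 h2 h3
  rw [h2, h1, ← mul_assoc, ← Complex.ofReal_mul, real_sign_mul_self h3]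
  simp

theorem inner_signMul_left (u v : L2R) : ⟪signMul u, v⟫_ℂ = ⟪u, signMul v⟫_ℂ := by
  rw [L2R.inner_eq, L2R.inner_eq]
  refine integral_congr_ae ?_
  filter_upwards [coeFn_signMul u, coeFn_signMul v] with x h1 h2
  rw [h1, h2, map_mul, Complex.conj_ofReal]
  ring

theorem inner_signMul_signMul (u v : L2R) : ⟪signMul u, signMul v⟫_ℂ = ⟪u, v⟫_ℂ := by
  rw [inner_signMul_left, signMul_signMul]

theorem norm_signMul (u : L2R) : ‖signMul u‖ = ‖u‖ := by
  rw [@norm_eq_sqrt_re_inner ℂ, inner_signMul_signMul, ← @norm_eq_sqrt_re_inner ℂ]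

/-- Multiplication by `sgn` as a bounded operator. -/
def signCLM : L2R →L[ℂ] L2R :=
  signMul.mkContinuous 1 fun u => by rw [norm_signMul, one_mul]

/-! ### Test functions -/

theorem contDiffAt_sign {x : ℝ} (hx : x ≠ 0) :
    ContDiffAt ℝ ∞ (fun y => (Real.sign y : ℂ)) x := by
  rcases lt_or_gt_of_ne hx with h | h
  · refine (contDiffAt_const (c := (-1 : ℂ))).congr_of_eventuallyEq ?_
    filter_upwards [Iio_mem_nhds h] with y hy
    simp [Real.sign_of_neg hy]
  · refine (contDiffAt_const (c := (1 : ℂ))).congr_of_eventuallyEq ?_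
    filter_upwards [Ioi_mem_nhds h] with y hy
    simp [Real.sign_of_pos hy]

theorem hasDerivAt_sign {x : ℝ} (hx : x ≠ 0) :
    HasDerivAt (fun y => (Real.sign y : ℂ)) 0 x := by
  rcases lt_or_gt_of_ne hx with h | h
  · refine (hasDerivAt_const x (-1 : ℂ)).congr_of_eventuallyEq ?_
    filter_upwards [Iio_mem_nhds h] with y hy
    simp [Real.sign_of_neg hy]
  · refine (hasDerivAt_const x (1 : ℂ)).congr_of_eventuallyEq ?_
    filter_upwards [Ioi_mem_nhds h] with y hy
    simp [Real.sign_of_pos hy]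

namespace IsTestFun

variable {φ : ℝ → ℂ}

theorem hasDerivAt (h : IsTestFun φ) (x : ℝ) : HasDerivAt φ (_root_.deriv φ x) x :=
  (h.1.differentiable (by simp) x).hasDerivAt

theorem eventuallyEq_zero (h : IsTestFun φ) : φ =ᶠ[nhds 0] 0 :=
  notMem_tsupport_iff_eventuallyEq.1 fun h0 => h.2.2 h0 rfl

theorem apply_zero (h : IsTestFun φ) : φ 0 = 0 := h.eventuallyEq_zero.eq_of_nhds

theorem star (h : IsTestFun φ) : IsTestFun (fun x => (starRingEnd ℂ) (φ x)) := by
  have ht : tsupport (fun x => (starRingEnd ℂ) (φ x)) = tsupport φ := by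
    have hsupp : Function.support (fun x => (starRingEnd ℂ) (φ x)) = Function.support φ := by
      ext x; simp
    rw [tsupport, hsupp, tsupport]
  refine ⟨Complex.conjCLE.contDiff.comp h.1, ?_, ?_⟩
  · rw [HasCompactSupport, ht]; exact h.2.1
  · rw [ht]; exact h.2.2

theorem deriv_star (h : IsTestFun φ) (x : ℝ) :
    _root_.deriv (fun x => (starRingEnd ℂ) (φ x)) x = (starRingEnd ℂ) (_root_.deriv φ x) :=
  (h.hasDerivAt x).star.deriv

/-- The product of a test function with a function that is smooth away from `0`. -/
theorem mul_left (h : IsTestFun φ) {e : ℝ → ℂ} (he : ∀ x, x ≠ 0 → ContDiffAt ℝ ∞ e x) :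
    IsTestFun (fun x => e x * φ x) := by
  have hs : tsupport (fun x => e x * φ x) ⊆ tsupport φ := tsupport_mul_subset_right
  refine ⟨contDiff_iff_contDiffAt.2 fun x => ?_, h.2.1.mul_left, hs.trans h.2.2⟩
  -- The factor `e` may be singular at `0`, where `φ` vanishes identically nearby. This is what
  -- admits `sgn` and `phase` as factors.
  by_cases hx : x = 0
  · subst hx
    refine (contDiffAt_const (c := (0 : ℂ))).congr_of_eventuallyEq ?_
    filter_upwards [h.eventuallyEq_zero] with y hy
    simp [hy]
  · exact (he x hx).mul h.1.contDiffAt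

theorem hasDerivAt_mul_left (h : IsTestFun φ) {e e' : ℝ → ℂ}
    (he : ∀ x, x ≠ 0 → HasDerivAt e (e' x) x) (x : ℝ) :
    HasDerivAt (fun x => e x * φ x) (e' x * φ x + e x * _root_.deriv φ x) x := by
  by_cases hx : x = 0
  · subst hx
    rw [h.apply_zero, h.deriv.apply_zero, mul_zero, mul_zero, add_zero]
    refine (hasDerivAt_const (0 : ℝ) (0 : ℂ)).congr_of_eventuallyEq ?_
    filter_upwards [h.eventuallyEq_zero] with y hy
    simp [hy]
  · exact (he x hx).mul (h.hasDerivAt x)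

theorem sign_mul (h : IsTestFun φ) : IsTestFun (fun x => (Real.sign x : ℂ) * φ x) :=
  h.mul_left fun _ => contDiffAt_sign

theorem deriv_sign_mul (h : IsTestFun φ) (x : ℝ) :
    _root_.deriv (fun x => (Real.sign x : ℂ) * φ x) x = (Real.sign x : ℂ) * _root_.deriv φ x := by
  simpa using (h.hasDerivAt_mul_left (e' := 0) (fun _ => hasDerivAt_sign) x).deriv

/-- The pair `(φ, φ')` in `L² × L²`. -/
def pair (h : IsTestFun φ) : L2R × L2R :=
  (h.memLp.toLp φ, h.deriv.memLp.toLp (_root_.deriv φ))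

theorem pair_mem (h : IsTestFun φ) : h.pair ∈ testPairs :=
  ⟨φ, h, h.memLp.coeFn_toLp, h.deriv.memLp.coeFn_toLp⟩

end IsTestFun

theorem mem_testPairs_iff {p : L2R × L2R} :
    p ∈ testPairs ↔ ∃ (φ : ℝ → ℂ) (h : IsTestFun φ), p = h.pair := by
  constructor
  · rintro ⟨φ, h, h1, h2⟩
    exact ⟨φ, h, Prod.ext (Lp.ext (h1.trans h.memLp.coeFn_toLp.symm))
      (Lp.ext (h2.trans h.deriv.memLp.coeFn_toLp.symm))⟩
  · rintro ⟨φ, h, rfl⟩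
    exact h.pair_mem

/-- Test functions are stable under conjugation, so the bilinear pairing can be traded for inner
products. Closedness of the graph is then immediate. -/
theorem mem_weakDerivGraph_iff {p : L2R × L2R} :
    p ∈ weakDerivGraph ↔ ∀ (φ : ℝ → ℂ) (h : IsTestFun φ),
      ⟪h.pair.2, p.1⟫_ℂ = -⟪h.pair.1, p.2⟫_ℂ := by
  constructor
  · intro hp φ h
    have := hp _ h.star
    simp only [h.deriv_star] at this
    rw [IsTestFun.pair, inner_toLp_left, inner_toLp_left, this]
  · intro hp φ h
    have := hp _ h.star
    simp only [IsTestFun.pair, inner_toLp_left, h.deriv_star, Complex.conj_conj] at this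
    exact this

theorem isClosed_weakDerivGraph : IsClosed (weakDerivGraph : Set (L2R × L2R)) := by
  have : (weakDerivGraph : Set (L2R × L2R)) = ⋂ (φ : ℝ → ℂ) (h : IsTestFun φ),
      {p | ⟪h.pair.2, p.1⟫_ℂ = -⟪h.pair.1, p.2⟫_ℂ} := by
    ext p
    simp only [Set.mem_iInter, Set.mem_ofPred_eq]
    exact mem_weakDerivGraph_iff
  rw [this]
  refine isClosed_iInter fun φ => isClosed_iInter fun h => isClosed_eq ?_ ?_ <;> fun_prop

theorem IsTestFun.pair_mem_weakDerivGraph {φ : ℝ → ℂ} (h : IsTestFun φ) :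
    h.pair ∈ weakDerivGraph := by
  intro χ hχ
  have e1 : ∫ x, h.pair.1 x * _root_.deriv χ x = ∫ x, φ x * _root_.deriv χ x := by
    refine integral_congr_ae ?_
    filter_upwards [h.memLp.coeFn_toLp] with x hx
    rw [IsTestFun.pair, hx]
  have e2 : ∫ x, h.pair.2 x * χ x = ∫ x, _root_.deriv φ x * χ x := by
    refine integral_congr_ae ?_
    filter_upwards [h.deriv.memLp.coeFn_toLp] with x hx
    rw [IsTestFun.pair, hx]
  rw [e1, e2]
  exact integral_mul_deriv_eq_deriv_mul_of_integrable (u := φ) (v := χ)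
    (fun x _ => h.hasDerivAt x) (fun x _ => hχ.hasDerivAt x)
    (h.memLp.integrable_mul hχ.deriv.memLp) (h.deriv.memLp.integrable_mul hχ.memLp)
    (h.memLp.integrable_mul hχ.memLp)

/-! ### The closure of the test functions in the graph norm -/

/-- All pairs `(ψ, ψ')` with `ψ ∈ W_0^{1,2}(ℝ ∖ {0})`, a closed subspace of `L² × L²`. -/
def sobolevPairs : Submodule ℂ (L2R × L2R) := testPairs.topologicalClosure

instance : CompleteSpace sobolevPairs :=
  (Submodule.isClosed_topologicalClosure testPairs).completeSpace_coe

theorem IsTestFun.pair_mem_sobolevPairs {φ : ℝ → ℂ} (h : IsTestFun φ) : h.pair ∈ sobolevPairs :=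
  Submodule.le_topologicalClosure _ h.pair_mem

theorem sobolevPairs_induction {P : L2R × L2R → Prop} (hP : IsClosed {p | P p})
    (h : ∀ (φ : ℝ → ℂ) (hφ : IsTestFun φ), P hφ.pair) {p : L2R × L2R} (hp : p ∈ sobolevPairs) :
    P p := by
  refine (hP.closure_subset_iff.2 ?_) (show p ∈ closure (testPairs : Set (L2R × L2R)) from hp)
  rintro q hq
  obtain ⟨φ, hφ, rfl⟩ := mem_testPairs_iff.1 hq
  exact h φ hφ

theorem sobolevPairs_le : sobolevPairs ≤ weakDerivGraph := fun _ hp =>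
  sobolevPairs_induction (P := (· ∈ weakDerivGraph)) isClosed_weakDerivGraph
    (fun _ h => h.pair_mem_weakDerivGraph) hp

theorem weakDeriv_eq {p : L2R × L2R} (hp : p ∈ weakDerivGraph) (h : p.1 ∈ W12) :
    weakDeriv ⟨p.1, h⟩ = p.2 := by
  have h1 := Submodule.mem_graph_toLinearPMap weakDerivGraph_functional ⟨p.1, h⟩
  exact sub_eq_zero.1 (weakDerivGraph_functional _ (weakDerivGraph.sub_mem h1 hp) (by simp))

theorem weakDeriv_mem {u : L2R} (h : u ∈ W12) : (u, weakDeriv ⟨u, h⟩) ∈ weakDerivGraph :=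
  Submodule.mem_graph_toLinearPMap weakDerivGraph_functional ⟨u, h⟩

theorem mem_W12_of_mem {p : L2R × L2R} (hp : p ∈ weakDerivGraph) : p.1 ∈ W12 := ⟨p, hp, rfl⟩

theorem mem_W12zero_of_mem {p : L2R × L2R} (hp : p ∈ sobolevPairs) : p.1 ∈ W12zero := by
  refine ⟨mem_W12_of_mem (sobolevPairs_le hp), ?_⟩
  rw [weakDeriv_eq (sobolevPairs_le hp)]
  exact hp

theorem W12zero.pair_mem (u : W12zero) : ((u : L2R), W12zero.deriv u) ∈ sobolevPairs := u.2.2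

theorem W12zero.deriv_eq {p : L2R × L2R} (hp : p ∈ sobolevPairs) (h : p.1 ∈ W12zero) :
    W12zero.deriv ⟨p.1, h⟩ = p.2 := weakDeriv_eq (sobolevPairs_le hp) _

/-- Integration by parts. -/
theorem inner_snd_fst {u v : L2R × L2R} (hv : v ∈ sobolevPairs) (hu : u ∈ weakDerivGraph) :
    ⟪v.2, u.1⟫_ℂ = -⟪v.1, u.2⟫_ℂ :=
  sobolevPairs_induction (P := fun v => ⟪v.2, u.1⟫_ℂ = -⟪v.1, u.2⟫_ℂ)
    (isClosed_eq (by fun_prop) (by fun_prop)) (fun φ h => mem_weakDerivGraph_iff.1 hu φ h) hv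

/-- `sgn` is locally constant off `0` and test functions vanish near `0`, so its jump is invisible:
`sgn · φ` is again a test function. -/
theorem signMul_mem_weakDerivGraph {u : L2R × L2R} (hu : u ∈ weakDerivGraph) :
    (signMul u.1, signMul u.2) ∈ weakDerivGraph := by
  intro φ h
  have := hu _ h.sign_mul
  simp only [h.deriv_sign_mul] at this
  refine (integral_congr_ae ?_).trans (this.trans (congrArg Neg.neg (integral_congr_ae ?_)))
  · filter_upwards [coeFn_signMul u.1] with x hx
    rw [hx]; ring
  · filter_upwards [coeFn_signMul u.2] with x hx
    rw [hx]; ring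

theorem inner_snd_signMul_fst {u v : L2R × L2R} (hv : v ∈ sobolevPairs)
    (hu : u ∈ weakDerivGraph) : ⟪v.2, signMul u.1⟫_ℂ = -⟪v.1, signMul u.2⟫_ℂ :=
  inner_snd_fst hv (signMul_mem_weakDerivGraph hu)

/-! ### A first order factor of the Dirichlet form -/

/-- The first order operator `(u, u') ↦ u' - i (α + β sgn) u`. -/
def firstOrder (α β : ℂ) : (L2R × L2R) →L[ℂ] L2R :=
  ContinuousLinearMap.snd ℂ L2R L2R -
    Complex.I • (α • ContinuousLinearMap.fst ℂ L2R L2R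
      + β • signCLM.comp (ContinuousLinearMap.fst ℂ L2R L2R))

theorem firstOrder_apply (α β : ℂ) (u : L2R × L2R) :
    firstOrder α β u = u.2 - Complex.I • (α • u.1 + β • signMul u.1) := rfl

/-- The cross terms between derivative and multiplication cancel by integration by parts, leaving
the square `(α + β sgn)² = α² + β² + 2αβ sgn`. The parameters `-conj α`, `-conj β` make the second
factor minus the formal adjoint of the first. -/
theorem inner_firstOrder {α β : ℂ} {u v : L2R × L2R} (hu : u ∈ sobolevPairs)
    (hv : v ∈ sobolevPairs) :
    ⟪firstOrder (-conj α) (-conj β) v, firstOrder α β u⟫_ℂ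
      = ⟪v.2, u.2⟫_ℂ - (α ^ 2 + β ^ 2) * ⟪v.1, u.1⟫_ℂ - 2 * α * β * ⟪v.1, signMul u.1⟫_ℂ := by
  have h1 := inner_snd_fst hv (sobolevPairs_le hu)
  have h2 := inner_snd_signMul_fst hv (sobolevPairs_le hu)
  simp only [firstOrder_apply, inner_sub_left, inner_sub_right, inner_smul_left, inner_smul_right,
    inner_add_left, inner_add_right, inner_signMul_left, h1, h2, map_neg,
    Complex.conj_I, Complex.conj_conj, signMul_signMul]
  ring_nf
  simp only [Complex.I_sq]
  ring

/-- Pair `L u` with `sgn · u`. The derivative contributes half of `∫ sgn (|u|²)'`, which vanishes by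
the Dirichlet condition. What remains has real part `Im α (sgn u, u) + Im β ‖u‖²`. -/
theorem mul_norm_fst_le_norm_firstOrder (α β : ℂ) {u : L2R × L2R} (hu : u ∈ sobolevPairs) :
    (β.im - |α.im|) * ‖u.1‖ ≤ ‖firstOrder α β u‖ := by
  have h1 : (⟪signMul u.1, u.2⟫_ℂ).re = 0 := by
    have h := inner_snd_signMul_fst hu (sobolevPairs_le hu)
    rw [← inner_signMul_left u.1, ← inner_conj_symm] at h
    have := congrArg Complex.re h
    rw [Complex.conj_re, Complex.neg_re] at this
    linarith
  have hr : (⟪signMul u.1, u.1⟫_ℂ).im = 0 := by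
    have h := inner_conj_symm (𝕜 := ℂ) (signMul u.1) u.1
    rw [← inner_signMul_left] at h
    have := congrArg Complex.im h
    rw [Complex.conj_im] at this
    linarith
  have hb : |(⟪signMul u.1, u.1⟫_ℂ).re| ≤ ‖u.1‖ * ‖u.1‖ := by
    refine (Complex.abs_re_le_norm _).trans ((norm_inner_le_norm _ _).trans ?_)
    rw [norm_signMul]
  have h2 : (⟪signMul u.1, firstOrder α β u⟫_ℂ).re
      = α.im * (⟪signMul u.1, u.1⟫_ℂ).re + β.im * (‖u.1‖ * ‖u.1‖) := by
    rw [firstOrder_apply, inner_sub_right, inner_smul_right, inner_add_right, inner_smul_right,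
      inner_smul_right, inner_signMul_signMul, inner_self_eq_norm_sq_to_K, ← sq]
    simp [h1, hr, ← Complex.ofReal_pow]
  have h3 : (⟪signMul u.1, firstOrder α β u⟫_ℂ).re ≤ ‖u.1‖ * ‖firstOrder α β u‖ := by
    refine (Complex.re_le_norm _).trans ((norm_inner_le_norm _ _).trans ?_)
    rw [norm_signMul]
  have h4 : -(|α.im| * (‖u.1‖ * ‖u.1‖)) ≤ α.im * (⟪signMul u.1, u.1⟫_ℂ).re := by
    refine le_trans ?_ (neg_abs_le _)
    rw [abs_mul]
    exact neg_le_neg (mul_le_mul_of_nonneg_left hb (abs_nonneg _))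
  rcases (norm_nonneg u.1).eq_or_lt with h0 | h0
  · rw [← h0, mul_zero]; exact norm_nonneg _
  · refine le_of_mul_le_mul_left ?_ h0
    linarith

/-- The previous estimate controls `u`, and `u' = L u + i(α + β sgn) u` then controls `u'`. This
gives injectivity and closed range. -/
theorem exists_norm_le_mul_norm_firstOrder {α β : ℂ} (h : |α.im| < β.im) :
    ∃ C : ℝ, 0 < C ∧ ∀ u ∈ sobolevPairs, ‖u‖ ≤ C * ‖firstOrder α β u‖ := by
  have hm : 0 < β.im - |α.im| := sub_pos.2 h
  set m := β.im - |α.im|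
  set K := ‖α‖ + ‖β‖
  have hK : 0 ≤ K := by positivity
  refine ⟨m⁻¹ + (1 + K * m⁻¹), by positivity, fun u hu => ?_⟩
  have h1 : ‖u.1‖ ≤ m⁻¹ * ‖firstOrder α β u‖ := by
    rw [inv_mul_eq_div, le_div_iff₀' hm]
    exact mul_norm_fst_le_norm_firstOrder α β hu
  have h2 : ‖u.2‖ ≤ ‖firstOrder α β u‖ + K * ‖u.1‖ := by
    have e : u.2 = firstOrder α β u + Complex.I • (α • u.1 + β • signMul u.1) := by
      rw [firstOrder_apply]; abel
    have e2 : ‖Complex.I • (α • u.1 + β • signMul u.1)‖ ≤ K * ‖u.1‖ := by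
      rw [norm_smul, Complex.norm_I, one_mul]
      refine (norm_add_le _ _).trans ?_
      rw [norm_smul, norm_smul, norm_signMul, add_mul]
    calc ‖u.2‖ = ‖firstOrder α β u + Complex.I • (α • u.1 + β • signMul u.1)‖ :=
          congrArg _ e
      _ ≤ _ := (norm_add_le _ _).trans (by gcongr)
  have h3 := mul_le_mul_of_nonneg_left h1 hK
  have h4 : 0 ≤ m⁻¹ * ‖firstOrder α β u‖ := by positivity
  have h5 : 0 ≤ K * (m⁻¹ * ‖firstOrder α β u‖) := by positivity
  rw [Prod.norm_def]
  refine max_le ?_ ?_ <;> nlinarith [norm_nonneg (firstOrder α β u)]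

/-! ### Pointwise formula for the first order operator and its exponential solutions. -/

theorem firstOrder_pair (α β : ℂ) {φ : ℝ → ℂ} (h : IsTestFun φ) :
    firstOrder α β h.pair =ᵐ[volume]
      fun x => deriv φ x - Complex.I * (α + β * Real.sign x) * φ x := by
  rw [firstOrder_apply]
  filter_upwards [Lp.coeFn_sub h.pair.2 (Complex.I • (α • h.pair.1 + β • signMul h.pair.1)),
    Lp.coeFn_smul Complex.I (α • h.pair.1 + β • signMul h.pair.1),
    Lp.coeFn_add (α • h.pair.1) (β • signMul h.pair.1), Lp.coeFn_smul α h.pair.1,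
    Lp.coeFn_smul β (signMul h.pair.1), coeFn_signMul h.pair.1, h.memLp.coeFn_toLp,
    h.deriv.memLp.coeFn_toLp] with x h1 h2 h3 h4 h5 h6 h7 h8
  rw [h1, Pi.sub_apply, h2, Pi.smul_apply, h3, Pi.add_apply, h4, h5, Pi.smul_apply, Pi.smul_apply,
    h6]
  simp only [IsTestFun.pair, h7, h8, smul_eq_mul]
  ring

/-- The exponential `exp (i (α x + β |x|))`, annihilated by `u ↦ u' - i (α + β sgn) u`. -/
def phase (α β : ℂ) (x : ℝ) : ℂ := Complex.exp (Complex.I * (α * x + β * |x|))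

theorem continuous_phase (α β : ℂ) : Continuous (phase α β) := by
  unfold phase; fun_prop

theorem phase_mul_phase_neg (α β : ℂ) (x : ℝ) : phase α β x * phase (-α) (-β) x = 1 := by
  rw [phase, phase, ← Complex.exp_add, ← Complex.exp_zero]
  congr 1; ring

theorem norm_phase_mul_phase (α β : ℂ) (x y : ℝ) : ‖phase α β x * phase (-α) (-β) y‖
    = Real.exp (-(α.im * (x - y) + β.im * (|x| - |y|))) := by
  rw [phase, phase, ← Complex.exp_add, Complex.norm_exp]
  congr 1
  simp
  ring

theorem norm_phase (α β : ℂ) (x : ℝ) :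
    ‖phase α β x‖ = Real.exp (-(α.im * x + β.im * |x|)) := by
  rw [phase, Complex.norm_exp]
  congr 1
  simp

theorem norm_phase_le_one {α β : ℂ} (h : |α.im| ≤ β.im) (x : ℝ) : ‖phase α β x‖ ≤ 1 := by
  rw [norm_phase, Real.exp_le_one_iff, neg_nonpos]
  have h1 : |α.im * x| ≤ β.im * |x| := by
    rw [abs_mul]; exact mul_le_mul_of_nonneg_right h (abs_nonneg x)
  linarith [neg_abs_le (α.im * x)]

theorem abs_eq_sign_mul_eventually {x : ℝ} (hx : x ≠ 0) :
    (fun y : ℝ => |y|) =ᶠ[nhds x] fun y => Real.sign x * y := by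
  rcases lt_or_gt_of_ne hx with h | h
  · filter_upwards [Iio_mem_nhds h] with y hy
    rw [abs_of_neg hy, Real.sign_of_neg h]; ring
  · filter_upwards [Ioi_mem_nhds h] with y hy
    rw [abs_of_pos hy, Real.sign_of_pos h]; ring

theorem phase_eventuallyEq (α β : ℂ) {x : ℝ} (hx : x ≠ 0) :
    phase α β =ᶠ[nhds x]
      fun y => Complex.exp (Complex.I * (α + β * Real.sign x) * (y : ℂ)) := by
  filter_upwards [abs_eq_sign_mul_eventually hx] with y hy
  rw [phase, hy]
  push_cast
  congr 1; ring

theorem contDiffAt_phase (α β : ℂ) {x : ℝ} (hx : x ≠ 0) : ContDiffAt ℝ ∞ (phase α β) x := by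
  refine ContDiffAt.congr_of_eventuallyEq ?_ (phase_eventuallyEq α β hx)
  exact ((contDiffAt_const.mul Complex.ofRealCLM.contDiff.contDiffAt).cexp)

theorem hasDerivAt_phase (α β : ℂ) {x : ℝ} (hx : x ≠ 0) :
    HasDerivAt (phase α β) (Complex.I * (α + β * Real.sign x) * phase α β x) x := by
  have h1 := (phase_eventuallyEq α β hx).eq_of_nhds
  rw [h1, mul_comm]
  refine HasDerivAt.congr_of_eventuallyEq ?_ (phase_eventuallyEq α β hx)
  have := ((Complex.ofRealCLM.hasDerivAt (x := x)).const_mul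
    (Complex.I * (α + β * Real.sign x))).cexp
  simpa using this

/-! ### The pointwise bound -/

theorem norm_toLp_sq {f : ℝ → ℂ} (hf : MemLp f 2 volume) :
    ‖hf.toLp f‖ ^ 2 = ∫ x, ‖f x‖ ^ 2 := by
  have h := inner_toLp_left hf (hf.toLp f)
  rw [inner_self_eq_norm_sq_to_K] at h
  have e : ∫ x, (hf.toLp f) x * conj (f x) = ((∫ x, ‖f x‖ ^ 2 : ℝ) : ℂ) := by
    rw [← integral_complex_ofReal]
    refine integral_congr_ae ?_
    filter_upwards [hf.coeFn_toLp] with x hx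
    rw [hx, Complex.mul_conj, Complex.normSq_eq_norm_sq]
  rw [e] at h
  exact Complex.ofReal_injective (by simpa using h)

theorem norm_sq_eq_integral (u : L2R) : ‖u‖ ^ 2 = ∫ x, ‖u x‖ ^ 2 := by
  conv_lhs => rw [← Lp.toLp_coeFn u (Lp.memLp u)]
  exact norm_toLp_sq _

theorem integrable_norm_sq {f : ℝ → ℂ} (hf : MemLp f 2 volume) :
    Integrable (fun x => ‖f x‖ ^ 2) :=
  (memLp_two_iff_integrable_sq_norm hf.1).1 hf

/-- Cauchy–Schwarz on an interval, obtained from `∫ (|f| - c)² ≥ 0`. -/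
theorem sq_setIntegral_norm_le {f : ℝ → ℂ} (hf : MemLp f 2 volume) (hc : Continuous f)
    {a b : ℝ} (hab : a ≤ b) :
    (∫ x in a..b, ‖f x‖) ^ 2 ≤ (b - a) * ∫ x, ‖f x‖ ^ 2 := by
  have h1 : ∫ x in a..b, ‖f x‖ ^ 2 ≤ ∫ x, ‖f x‖ ^ 2 := by
    rw [intervalIntegral.integral_of_le hab]
    exact setIntegral_le_integral (integrable_norm_sq hf)
      (Filter.Eventually.of_forall fun x => by positivity)
  rcases hab.eq_or_lt with rfl | hlt
  · simp
  set A := ∫ x in a..b, ‖f x‖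
  have h2 : ∀ c : ℝ, 0 ≤ (∫ x in a..b, ‖f x‖ ^ 2) - 2 * c * A + c ^ 2 * (b - a) := by
    intro c
    have e : ∫ x in a..b, (‖f x‖ - c) ^ 2
        = (∫ x in a..b, ‖f x‖ ^ 2) - 2 * c * A + c ^ 2 * (b - a) := by
      have : ∀ x, (‖f x‖ - c) ^ 2 = ‖f x‖ ^ 2 - 2 * c * ‖f x‖ + c ^ 2 := fun x => by ring
      simp only [this]
      rw [intervalIntegral.integral_add, intervalIntegral.integral_sub,
        intervalIntegral.integral_const_mul, intervalIntegral.integral_const]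
      · simp only [smul_eq_mul]; ring
      all_goals exact Continuous.intervalIntegrable (by fun_prop) _ _
    rw [← e]
    exact intervalIntegral.integral_nonneg hab fun x _ => sq_nonneg _
  -- The optimal `c` is the mean of `|f|` over the interval.
  have h3 := h2 (A / (b - a))
  have hd : 0 < b - a := sub_pos.2 hlt
  have e : (A / (b - a)) ^ 2 * (b - a) = A ^ 2 / (b - a) := by field_simp
  have e2 : 2 * (A / (b - a)) * A = 2 * (A ^ 2 / (b - a)) := by ring
  rw [e, e2] at h3
  have h4 : A ^ 2 / (b - a) ≤ ∫ x, ‖f x‖ ^ 2 := by linarith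
  rwa [div_le_iff₀' hd] at h4

theorem IsTestFun.firstOrder {φ : ℝ → ℂ} (h : IsTestFun φ) (α β : ℂ) :
    IsTestFun fun x => _root_.deriv φ x - Complex.I * (α + β * Real.sign x) * φ x := by
  have h2 : IsTestFun fun x => Complex.I * (α + β * Real.sign x) * φ x :=
    h.mul_left fun x hx => contDiffAt_const.mul (contDiffAt_const.add
      (contDiffAt_const.mul (contDiffAt_sign hx)))
  exact ⟨h.deriv.1.sub h2.1, h.deriv.2.1.sub h2.2.1,
    (tsupport_sub _ _).trans (Set.union_subset h.deriv.2.2 h2.2.2)⟩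

/-- Variation of constants from `0`, where `φ` vanishes, followed by Cauchy–Schwarz on the interval
between `0` and `x`. The only constant is its length `|x|`, whatever `α` and `β` are. -/
theorem IsTestFun.norm_sq_le {φ : ℝ → ℂ} (h : IsTestFun φ) {α β : ℂ} (hαβ : |α.im| ≤ β.im)
    (x : ℝ) : ‖φ x‖ ^ 2 ≤ |x| * ‖_root_.firstOrder α β h.pair‖ ^ 2 := by
  have hg := h.firstOrder α β
  set g := fun x => _root_.deriv φ x - Complex.I * (α + β * Real.sign x) * φ x with hgdef
  have hn : ‖_root_.firstOrder α β h.pair‖ ^ 2 = ∫ x, ‖g x‖ ^ 2 := by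
    rw [norm_sq_eq_integral]
    refine integral_congr_ae ?_
    filter_upwards [firstOrder_pair α β h] with x hx
    rw [hx]
  have hd : ∀ y, HasDerivAt (fun y => phase (-α) (-β) y * φ y) (phase (-α) (-β) y * g y) y := by
    intro y
    have := h.hasDerivAt_mul_left (fun x => hasDerivAt_phase (-α) (-β) (x := x)) y
    convert this using 1
    simp only [hgdef]; ring
  have hcont : Continuous fun y => phase (-α) (-β) y * g y :=
    (continuous_phase _ _).mul hg.1.continuous
  have h1 : φ x = ∫ y in (0 : ℝ)..x, phase α β x * (phase (-α) (-β) y * g y) := by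
    rw [intervalIntegral.integral_const_mul,
      intervalIntegral.integral_eq_sub_of_hasDerivAt (fun y _ => hd y)
        (hcont.intervalIntegrable _ _), h.apply_zero, mul_zero, sub_zero, ← mul_assoc,
      phase_mul_phase_neg, one_mul]
  have hle : ∀ y ∈ Set.uIoc 0 x, ‖phase α β x * (phase (-α) (-β) y * g y)‖ ≤ ‖g y‖ := by
    intro y hy
    rw [← mul_assoc, norm_mul]
    refine mul_le_of_le_one_left (norm_nonneg _) ?_
    rw [norm_phase_mul_phase, Real.exp_le_one_iff, neg_nonpos]
    -- As `y` lies between `0` and `x`, the exponent is `-(Im α (x - y) + Im β |x - y|) ≤ 0`.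
    have e : |x| - |y| = |x - y| := by
      rcases le_total 0 x with h0 | h0
      · rw [Set.uIoc_of_le h0] at hy
        rw [abs_of_nonneg h0, abs_of_pos hy.1, abs_of_nonneg (sub_nonneg.2 hy.2)]
      · rw [Set.uIoc_of_ge h0] at hy
        rw [abs_of_nonpos h0, abs_of_nonpos hy.2, abs_of_nonpos (sub_nonpos.2 hy.1.le)]; ring
    rw [e]
    have h1 : |α.im * (x - y)| ≤ β.im * |x - y| := by
      rw [abs_mul]; exact mul_le_mul_of_nonneg_right hαβ (abs_nonneg _)
    linarith [neg_abs_le (α.im * (x - y))]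
  have h2 : ‖φ x‖ ≤ |∫ y in (0 : ℝ)..x, ‖g y‖| := by
    rw [h1]
    refine intervalIntegral.norm_integral_le_abs_of_norm_le ?_
      (hg.1.continuous.norm.intervalIntegrable _ _)
    exact (ae_restrict_iff' measurableSet_uIoc).2 (Filter.Eventually.of_forall hle)
  have h3 : (∫ y in (0 : ℝ)..x, ‖g y‖) ^ 2 ≤ |x| * ∫ x, ‖g x‖ ^ 2 := by
    rcases le_total 0 x with h0 | h0
    · have := sq_setIntegral_norm_le hg.memLp hg.1.continuous h0
      rw [abs_of_nonneg h0]
      rwa [sub_zero] at this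
    · have := sq_setIntegral_norm_le hg.memLp hg.1.continuous h0
      rw [intervalIntegral.integral_symm, neg_sq, abs_of_nonpos h0]
      rwa [zero_sub] at this
  rw [hn]
  refine le_trans ?_ h3
  rw [← sq_abs (∫ y in (0 : ℝ)..x, ‖g y‖)]
  exact pow_le_pow_left₀ (norm_nonneg _) h2 2

theorem ae_norm_sq_le {α β : ℂ} (hαβ : |α.im| ≤ β.im) {u : L2R × L2R} (hu : u ∈ sobolevPairs) :
    ∀ᵐ x, ‖u.1 x‖ ^ 2 ≤ |x| * ‖firstOrder α β u‖ ^ 2 := by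
  obtain ⟨p, hp, hlim⟩ := mem_closure_iff_seq_limit.1
    (show u ∈ closure (testPairs : Set (L2R × L2R)) from hu)
  have h1 : Filter.Tendsto (fun n => (p n).1) Filter.atTop (nhds u.1) :=
    (continuous_fst.tendsto u).comp hlim
  -- Convergence in `L²` gives almost everywhere convergence along a subsequence, along which the
  -- bound for test functions passes to the limit.
  obtain ⟨ns, hns, hae⟩ := (tendstoInMeasure_of_tendsto_Lp h1).exists_seq_tendsto_ae
  have h2 : ∀ n, ∀ᵐ x, ‖(p n).1 x‖ ^ 2 ≤ |x| * ‖firstOrder α β (p n)‖ ^ 2 := by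
    intro n
    obtain ⟨φ, hφ, e⟩ := mem_testPairs_iff.1 (hp n)
    rw [e]
    filter_upwards [hφ.memLp.coeFn_toLp] with x hx
    rw [IsTestFun.pair, hx]
    exact hφ.norm_sq_le hαβ x
  filter_upwards [hae, ae_all_iff.2 h2] with x hx hx2
  refine le_of_tendsto_of_tendsto (hx.norm.pow 2) (Filter.Tendsto.const_mul _ ?_)
    (Filter.Eventually.of_forall fun i => hx2 (ns i))
  exact ((((firstOrder α β).continuous.tendsto u).comp (hlim.comp hns.tendsto_atTop)).norm).pow 2

/-! ### Dilations and primitives of test functions -/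

theorem isTestFun_iff {φ : ℝ → ℂ} :
    IsTestFun φ ↔ ContDiff ℝ ∞ φ ∧ HasCompactSupport φ ∧ φ =ᶠ[nhds 0] 0 := by
  rw [IsTestFun, Set.subset_compl_singleton_iff, notMem_tsupport_iff_eventuallyEq]

theorem IsTestFun.comp_mul_left {φ : ℝ → ℂ} (h : IsTestFun φ) {c : ℝ} (hc : c ≠ 0) :
    IsTestFun fun x => φ (c * x) := by
  refine isTestFun_iff.2 ⟨h.1.comp (contDiff_const.mul contDiff_id),
    h.2.1.comp_homeomorph (Homeomorph.mulLeft₀ c hc), ?_⟩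
  have ht : Filter.Tendsto (fun x : ℝ => c * x) (nhds 0) (nhds 0) := by
    have : Continuous fun x : ℝ => c * x := by fun_prop
    simpa using this.tendsto 0
  exact ht.eventually h.eventuallyEq_zero

theorem IsTestFun.const_mul {φ : ℝ → ℂ} (h : IsTestFun φ) (c : ℂ) :
    IsTestFun fun x => c * φ x :=
  h.mul_left fun _ _ => contDiffAt_const

theorem IsTestFun.sub {φ χ : ℝ → ℂ} (h : IsTestFun φ) (h' : IsTestFun χ) :
    IsTestFun fun x => φ x - χ x :=
  ⟨h.1.sub h'.1, h.2.1.sub h'.2.1, (tsupport_sub _ _).trans (Set.union_subset h.2.2 h'.2.2)⟩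

theorem IsTestFun.integrable {φ : ℝ → ℂ} (h : IsTestFun φ) : Integrable φ :=
  h.1.continuous.integrable_of_hasCompactSupport h.2.1

/-- Test functions of mean one, supported in one of the two half-lines. -/
theorem exists_testFun_integral_eq_one {σ : ℝ} (hσ : σ = 1 ∨ σ = -1) :
    ∃ ρ : ℝ → ℂ, IsTestFun ρ ∧ (∀ x, σ * x ≤ 0 → ρ x = 0) ∧ ∫ x, ρ x = 1 := by
  have h2 : |σ| = 1 := by rcases hσ with rfl | rfl <;> simp
  let f : ContDiffBump (2 * σ) := ⟨1 / 2, 1, by norm_num, by norm_num⟩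
  have hz : ∀ x, f.normed volume x ≠ 0 → 1 < σ * x := by
    intro x hx
    have hx : x ∈ Function.support (f.normed volume) := hx
    rw [f.support_normed_eq, Metric.mem_ball, Real.dist_eq] at hx
    have hx : |x - 2 * σ| < 1 := hx
    rw [abs_lt] at hx
    rcases hσ with rfl | rfl <;> linarith [hx.1, hx.2]
  refine ⟨fun x => ((f.normed volume x : ℝ) : ℂ), isTestFun_iff.2 ⟨?_, ?_, ?_⟩, ?_, ?_⟩
  · exact Complex.ofRealCLM.contDiff.comp f.contDiff_normed
  · exact f.hasCompactSupport_normed.comp_left (g := fun x : ℝ => (x : ℂ)) (by simp)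
  · filter_upwards [Metric.ball_mem_nhds (0 : ℝ) one_pos] with x hx
    by_contra hne
    have := hz x fun h => hne (by simp [h])
    rw [Metric.mem_ball, Real.dist_eq, sub_zero] at hx
    have h3 : |σ * x| < 1 := by rwa [abs_mul, h2, one_mul]
    linarith [le_abs_self (σ * x)]
  · intro x hx
    by_contra hne
    have := hz x fun h => hne (by simp [h])
    linarith
  · rw [integral_complex_ofReal, f.integral_normed]; simp

/-- The primitive starting at `0` vanishes near `0`. Together the hypotheses say that `χ` has mean
zero on each half-line, which makes this primitive vanish near both infinities. -/
theorem IsTestFun.exists_primitive {χ : ℝ → ℂ} (h : IsTestFun χ) (h1 : ∫ x in Set.Iic 0, χ x = 0)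
    (h2 : ∫ x, χ x = 0) : ∃ θ : ℝ → ℂ, IsTestFun θ ∧ ∀ x, HasDerivAt θ (χ x) x := by
  have hd : ∀ x, HasDerivAt (fun x => ∫ y in (0 : ℝ)..x, χ y) (χ x) x := fun x =>
    (h.1.continuous.integral_hasStrictDerivAt 0 x).hasDerivAt
  have he : ∀ x, ∫ y in (0 : ℝ)..x, χ y = ∫ y in Set.Iic x, χ y := by
    intro x
    rw [← intervalIntegral.integral_Iic_sub_Iic h.integrable.integrableOn
      h.integrable.integrableOn, h1, sub_zero]
  obtain ⟨R, hR⟩ := h.2.1.isCompact.isBounded.subset_closedBall 0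
  have hz : ∀ y, R < |y| → χ y = 0 := by
    intro y hy
    by_contra hne
    have := hR (subset_tsupport χ hne)
    rw [Metric.mem_closedBall, Real.dist_eq, sub_zero] at this
    linarith
  refine ⟨fun x => ∫ y in (0 : ℝ)..x, χ y, isTestFun_iff.2 ⟨?_, ?_, ?_⟩, hd⟩
  · refine contDiff_infty_iff_deriv.2 ⟨fun x => (hd x).differentiableAt, ?_⟩
    have : _root_.deriv (fun x => ∫ y in (0 : ℝ)..x, χ y) = χ := funext fun x => (hd x).deriv
    rw [this]
    exact h.1
  · refine HasCompactSupport.intro (isCompact_Icc (a := -R) (b := R)) fun x hx => ?_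
    rw [he]
    rw [Set.mem_Icc, not_and_or, not_le, not_le] at hx
    rcases hx with hx | hx
    · refine setIntegral_eq_zero_of_forall_eq_zero fun y hy => hz y ?_
      exact lt_of_lt_of_le (by linarith [Set.mem_Iic.1 hy]) (neg_le_abs y)
    · rw [← h2]
      refine setIntegral_eq_integral_of_forall_compl_eq_zero fun y hy => hz y ?_
      exact lt_of_lt_of_le (hx.trans (not_le.1 hy)) (le_abs_self y)
  · obtain ⟨r, hr, hball⟩ := Metric.eventually_nhds_iff_ball.1 h.eventuallyEq_zero
    filter_upwards [Metric.ball_mem_nhds (0 : ℝ) hr] with x hx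
    have : ∫ y in (0 : ℝ)..x, χ y = ∫ y in (0 : ℝ)..x, 0 := by
      refine intervalIntegral.integral_congr fun y hy => hball y ?_
      exact (convex_ball (0 : ℝ) r).ordConnected.uIcc_subset (Metric.mem_ball_self hr) hx hy
    rw [this]; simp

/-! ### The first order operator is an isomorphism -/

theorem norm_sq_integral_mul_conj_le {f : ℝ → ℂ} (hf : MemLp f 2 volume) (q : L2R) :
    ‖∫ x, q x * conj (f x)‖ ^ 2 ≤ ‖q‖ ^ 2 * ∫ x, ‖f x‖ ^ 2 := by
  rw [← inner_toLp_left hf, ← norm_toLp_sq hf, ← mul_pow, mul_comm]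
  exact pow_le_pow_left₀ (norm_nonneg _) (norm_inner_le_norm _ _) 2

/-- The function `c ρ(c ·)` keeps its integral while its `L²` norm is of order `√c`, and the
exponential factor has modulus at most one. -/
theorem tendsto_dilation_zero {α β : ℂ} (hαβ : |α.im| ≤ β.im) {ρ : ℝ → ℂ} (hρ : IsTestFun ρ)
    (q : L2R) :
    Filter.Tendsto (fun c : ℝ => (c : ℂ) * ∫ x, q x * conj (phase α β x * ρ (c * x)))
      (nhdsWithin 0 (Set.Ioi 0)) (nhds 0) := by
  set K := ‖q‖ ^ 2 * ∫ x, ‖ρ x‖ ^ 2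
  have hlim : Filter.Tendsto (fun c : ℝ => √(c * K)) (nhdsWithin 0 (Set.Ioi 0)) (nhds 0) := by
    have : Continuous fun c : ℝ => √(c * K) := by fun_prop
    have := this.tendsto 0
    simp only [zero_mul, Real.sqrt_zero] at this
    exact this.mono_left nhdsWithin_le_nhds
  refine squeeze_zero_norm' ?_ hlim
  filter_upwards [self_mem_nhdsWithin] with c hc
  have hc : 0 < c := hc
  have ht : IsTestFun fun x => ρ (c * x) := hρ.comp_mul_left hc.ne'
  have hp := ht.mul_left fun x hx => contDiffAt_phase α β hx
  refine Real.le_sqrt_of_sq_le ?_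
  have h1 := norm_sq_integral_mul_conj_le hp.memLp q
  have h2 : ∫ x, ‖phase α β x * ρ (c * x)‖ ^ 2 ≤ c⁻¹ * ∫ x, ‖ρ x‖ ^ 2 := by
    have e : ∫ x, ‖ρ (c * x)‖ ^ 2 = c⁻¹ * ∫ x, ‖ρ x‖ ^ 2 := by
      rw [Measure.integral_comp_mul_left (fun x => ‖ρ x‖ ^ 2) c, abs_of_pos (inv_pos.2 hc),
        smul_eq_mul]
    rw [← e]
    refine integral_mono (integrable_norm_sq hp.memLp) (integrable_norm_sq ht.memLp) fun x => ?_
    refine pow_le_pow_left₀ (norm_nonneg _) ?_ 2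
    rw [norm_mul]
    exact mul_le_of_le_one_left (norm_nonneg _) (norm_phase_le_one hαβ x)
  rw [norm_mul, mul_pow, Complex.norm_real, Real.norm_eq_abs, sq_abs]
  calc c ^ 2 * ‖∫ x, q x * conj (phase α β x * ρ (c * x))‖ ^ 2
      ≤ c ^ 2 * (‖q‖ ^ 2 * (c⁻¹ * ∫ x, ‖ρ x‖ ^ 2)) := by
        refine mul_le_mul_of_nonneg_left (h1.trans ?_) (sq_nonneg c)
        exact mul_le_mul_of_nonneg_left h2 (sq_nonneg _)
    _ = c * K := by field_simp [K]; simp only [K]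

/-- Density of the range. Conjugating by `phase` turns `L` into `d/dx`, so `q` annihilates `phase ·
θ'` for every test function `θ`. Derivatives of test functions are the test functions of mean zero
on each half-line. This mean condition can be removed by corrections of arbitrarily small `L²` norm.
-/
theorem eq_zero_of_inner_firstOrder {α β : ℂ} (hαβ : |α.im| ≤ β.im) {q : L2R}
    (hq : ∀ (φ : ℝ → ℂ) (h : IsTestFun φ), ⟪firstOrder α β h.pair, q⟫_ℂ = 0) : q = 0 := by
  have h0 : ∀ θ χ : ℝ → ℂ, IsTestFun θ → (∀ x, HasDerivAt θ (χ x) x) →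
      ∫ x, q x * conj (phase α β x * χ x) = 0 := by
    intro θ χ hθ hd
    have hφ := hθ.mul_left fun x hx => contDiffAt_phase α β hx
    rw [← hq _ hφ, L2R.inner_eq]
    refine integral_congr_ae ?_
    filter_upwards [firstOrder_pair α β hφ] with x hx
    rw [hx, (hθ.hasDerivAt_mul_left (fun x => hasDerivAt_phase α β (x := x)) x).deriv,
      (hd x).deriv]
    congr 2
    ring
  obtain ⟨ρ₁, hρ₁, hs₁, hi₁⟩ := exists_testFun_integral_eq_one (σ := 1) (Or.inl rfl)
  obtain ⟨ρ₂, hρ₂, hs₂, hi₂⟩ := exists_testFun_integral_eq_one (σ := -1) (Or.inr rfl)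
  have h1 : ∀ χ : ℝ → ℂ, IsTestFun χ → ∫ x, q x * conj (phase α β x * χ x) = 0 := by
    intro χ hχ
    set b := ∫ x in Set.Iic 0, χ x with hb
    set a := (∫ x, χ x) - b with ha
    -- Subtract `a c ρ₁(c x) + b c ρ₂(c x)` from `χ`, where `a` and `b` are its integrals over the
    -- right and left half-lines. The difference has a primitive that is a test function.
    have key : ∀ c : ℝ, 0 < c → ∫ x, q x * conj (phase α β x * χ x)
        = conj a * (c * ∫ x, q x * conj (phase α β x * ρ₁ (c * x)))
          + conj b * (c * ∫ x, q x * conj (phase α β x * ρ₂ (c * x))) := by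
      intro c hc
      have t₁ := hρ₁.comp_mul_left hc.ne'
      have t₂ := hρ₂.comp_mul_left hc.ne'
      have ht := (hχ.sub (t₁.const_mul (a * c))).sub (t₂.const_mul (b * c))
      have hc0 : (c : ℂ) ≠ 0 := by exact_mod_cast hc.ne'
      have i₁ : ∫ x, ρ₁ (c * x) = (c : ℂ)⁻¹ := by
        rw [Measure.integral_comp_mul_left ρ₁ c, hi₁, abs_of_pos (inv_pos.2 hc)]; simp
      have i₂ : ∫ x, ρ₂ (c * x) = (c : ℂ)⁻¹ := by
        rw [Measure.integral_comp_mul_left ρ₂ c, hi₂, abs_of_pos (inv_pos.2 hc)]; simp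
      have j₁ : ∫ x in Set.Iic 0, ρ₁ (c * x) = 0 :=
        setIntegral_eq_zero_of_forall_eq_zero fun x hx => hs₁ _ (by
          rw [one_mul]; exact mul_nonpos_of_nonneg_of_nonpos hc.le hx)
      have j₂ : ∫ x in Set.Iic 0, ρ₂ (c * x) = (c : ℂ)⁻¹ := by
        rw [← i₂]
        refine setIntegral_eq_integral_of_forall_compl_eq_zero fun x hx => hs₂ _ ?_
        have : 0 < x := not_le.1 hx
        nlinarith
      obtain ⟨θ, hθ, hd⟩ := ht.exists_primitive (by
          rw [integral_sub, integral_sub, integral_const_mul, integral_const_mul, j₁, j₂]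
          · field_simp; rw [← hb]; ring
          · exact hχ.integrable.integrableOn
          · exact (t₁.const_mul _).integrable.integrableOn
          · exact (hχ.sub (t₁.const_mul (a * c))).integrable.integrableOn
          · exact (t₂.const_mul _).integrable.integrableOn) (by
          rw [integral_sub, integral_sub, integral_const_mul, integral_const_mul, i₁, i₂]
          · field_simp; rw [ha]; ring
          · exact hχ.integrable
          · exact (t₁.const_mul _).integrable
          · exact (hχ.sub (t₁.const_mul (a * c))).integrable
          · exact (t₂.const_mul _).integrable)
      have hJ := h0 θ _ hθ hd
      have hint : ∀ f : ℝ → ℂ, IsTestFun f →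
          Integrable fun x => q x * conj (phase α β x * f x) := fun f hf =>
        (hf.mul_left fun x hx => contDiffAt_phase α β hx).star.integrable_mul q
      have e : ∀ x, q x * conj (phase α β x * (χ x - a * c * ρ₁ (c * x) - b * c * ρ₂ (c * x)))
          = q x * conj (phase α β x * χ x)
            - conj a * c * (q x * conj (phase α β x * ρ₁ (c * x)))
            - conj b * c * (q x * conj (phase α β x * ρ₂ (c * x))) := by
        intro x
        simp only [map_mul, map_sub, Complex.conj_ofReal]
        ring
      simp only [e] at hJ
      have g₁ := (hint _ t₁).const_mul (conj a * c)
      have g₂ := (hint _ t₂).const_mul (conj b * c)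
      rw [integral_sub ((hint χ hχ).sub' g₁) g₂, integral_sub (hint χ hχ) g₁, integral_const_mul,
        integral_const_mul, sub_sub, sub_eq_zero] at hJ
      rw [hJ]; ring
    have hlim := ((tendsto_dilation_zero hαβ hρ₁ q).const_mul (conj a)).add
      ((tendsto_dilation_zero hαβ hρ₂ q).const_mul (conj b))
    simp only [mul_zero, add_zero] at hlim
    refine tendsto_nhds_unique (Filter.Tendsto.congr' ?_
      (tendsto_const_nhds (f := nhdsWithin (0 : ℝ) (Set.Ioi 0)))) hlim
    filter_upwards [self_mem_nhdsWithin] with c hc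
    exact key c hc
  -- Multiplying by the inverse exponential keeps test functions, so `phase` can be absorbed.
  refine eq_zero_of_testFun fun h hh => ?_
  have := h1 _ (hh.star.mul_left fun x hx => contDiffAt_phase (-α) (-β) hx)
  simp only [← mul_assoc, phase_mul_phase_neg, one_mul, Complex.conj_conj] at this
  exact this

/-- For `|Im α| < Im β`, the operator `u ↦ u' - i (α + β sgn) u` maps `W_0^{1,2}(ℝ ∖ {0})`
isomorphically onto `L²(ℝ)`. -/
def firstOrderEquiv {α β : ℂ} (h : |α.im| < β.im) : sobolevPairs ≃L[ℂ] L2R :=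
  ContinuousLinearEquiv.ofBijective ((firstOrder α β).comp sobolevPairs.subtypeL)
    (by
      obtain ⟨C, -, hC⟩ := exists_norm_le_mul_norm_firstOrder h
      refine LinearMap.ker_eq_bot'.2 fun u hu => ?_
      have h1 := hC u u.2
      have h2 : firstOrder α β u = 0 := hu
      rw [h2, norm_zero, mul_zero] at h1
      exact norm_le_zero_iff.1 h1)
    (by
      obtain ⟨C, hC0, hC⟩ := exists_norm_le_mul_norm_firstOrder h
      set f := (firstOrder α β).comp sobolevPairs.subtypeL
      have hanti : AntilipschitzWith ⟨C, hC0.le⟩ f :=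
        f.antilipschitz_of_bound fun u => hC u u.2
      -- The lower bound makes the range closed, so it remains to see that its orthogonal complement
      -- is trivial.
      have hcl : IsClosed ((f : sobolevPairs →ₗ[ℂ] L2R).range : Set L2R) :=
        hanti.isClosed_range f.uniformContinuous
      rw [← hcl.submodule_topologicalClosure_eq, Submodule.topologicalClosure_eq_top_iff,
        Submodule.eq_bot_iff]
      intro q hq
      refine eq_zero_of_inner_firstOrder h.le fun φ hφ => ?_
      exact (Submodule.mem_orthogonal _ _).1 hq _ ⟨⟨hφ.pair, hφ.pair_mem_sobolevPairs⟩, rfl⟩)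

theorem firstOrderEquiv_apply {α β : ℂ} (h : |α.im| < β.im) (u : sobolevPairs) :
    firstOrderEquiv h u = firstOrder α β u := rfl

theorem firstOrder_firstOrderEquiv_symm {α β : ℂ} (h : |α.im| < β.im) (p : L2R) :
    firstOrder α β ((firstOrderEquiv h).symm p) = p := by
  rw [← firstOrderEquiv_apply h, ContinuousLinearEquiv.apply_symm_apply]

/-! ### The potential as a relatively small form -/

section Potential

variable {W : L1R}

theorem ae_norm_le {α β : ℂ} (hαβ : |α.im| ≤ β.im) {u : L2R × L2R} (hu : u ∈ sobolevPairs) :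
    ∀ᵐ x, ‖u.1 x‖ ≤ √|x| * ‖firstOrder α β u‖ := by
  filter_upwards [ae_norm_sq_le hαβ hu] with x hx
  refine (pow_le_pow_iff_left₀ (norm_nonneg _) (by positivity) two_ne_zero).1 ?_
  rwa [mul_pow, Real.sq_sqrt (abs_nonneg x)]

theorem aestronglyMeasurable_sqrt_norm (W : L1R) :
    AEStronglyMeasurable (fun x => (√‖W x‖ : ℂ)) (volume : Measure ℝ) :=
  (Complex.continuous_ofReal.comp Real.continuous_sqrt).comp_aestronglyMeasurable
    (Lp.aestronglyMeasurable W).norm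

theorem fst_mem_potentialDom (hW : Integrable fun x : ℝ => |x| * ‖W x‖) {u : L2R × L2R}
    (hu : u ∈ sobolevPairs) : u.1 ∈ potentialDom W := by
  have hm : AEStronglyMeasurable (fun x => (√‖W x‖ : ℂ) * u.1 x) (volume : Measure ℝ) :=
    (aestronglyMeasurable_sqrt_norm W).mul (Lp.aestronglyMeasurable _)
  refine (memLp_two_iff_integrable_sq_norm hm).2 ?_
  refine (hW.mul_const (‖firstOrder 0 Complex.I u‖ ^ 2)).mono' (hm.norm.pow 2) ?_
  filter_upwards [ae_norm_sq_le (α := 0) (β := Complex.I) (by simp) hu] with x hx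
  rw [Real.norm_eq_abs, abs_of_nonneg (sq_nonneg _), norm_mul, mul_pow, Complex.norm_real,
    Real.norm_eq_abs, sq_abs, Real.sq_sqrt (norm_nonneg _)]
  calc ‖W x‖ * ‖u.1 x‖ ^ 2 ≤ ‖W x‖ * (|x| * ‖firstOrder 0 Complex.I u‖ ^ 2) := by gcongr
    _ = _ := by ring

theorem fst_mem_perturbedForm_dom (hW : Integrable fun x : ℝ => |x| * ‖W x‖) {u : L2R × L2R}
    (hu : u ∈ sobolevPairs) : u.1 ∈ (perturbedForm W).dom :=
  ⟨mem_W12zero_of_mem hu, fst_mem_potentialDom hW hu⟩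

/-- Each of the two functions contributes a factor `√|x|`, so the first moment of the potential is
the exact constant that comes out. -/
theorem norm_integral_potential_le (hW : Integrable fun x : ℝ => |x| * ‖W x‖) {α β α' β' : ℂ}
    (h : |α.im| ≤ β.im) (h' : |α'.im| ≤ β'.im) {u v : L2R × L2R} (hu : u ∈ sobolevPairs)
    (hv : v ∈ sobolevPairs) :
    ‖∫ x, W x * u.1 x * conj (v.1 x)‖
      ≤ (∫ x, |x| * ‖W x‖) * ‖firstOrder α β u‖ * ‖firstOrder α' β' v‖ := by
  rw [← integral_mul_const, ← integral_mul_const]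
  refine norm_integral_le_of_norm_le ((hW.mul_const _).mul_const _) ?_
  filter_upwards [ae_norm_le h hu, ae_norm_le h' hv] with x h1 h2
  rw [norm_mul, norm_mul, RCLike.norm_conj]
  calc ‖W x‖ * ‖u.1 x‖ * ‖v.1 x‖
      ≤ ‖W x‖ * (√|x| * ‖firstOrder α β u‖) * (√|x| * ‖firstOrder α' β' v‖) := by gcongr
    _ = (√|x| * √|x|) * ‖W x‖ * ‖firstOrder α β u‖ * ‖firstOrder α' β' v‖ := by ring
    _ = _ := by rw [Real.mul_self_sqrt (abs_nonneg x)]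

/-- The form of a potential, in terms of the first order operators. -/
theorem exists_potentialOp (hW : Integrable fun x : ℝ => |x| * ‖W x‖) {α β α' β' : ℂ}
    (h : |α.im| < β.im) (h' : |α'.im| < β'.im) :
    ∃ S : L2R →L[ℂ] L2R, ‖S‖ ≤ ∫ x, |x| * ‖W x‖ ∧ ∀ u ∈ sobolevPairs, ∀ v ∈ sobolevPairs,
      ⟪firstOrder α' β' v, S (firstOrder α β u)⟫_ℂ = ∫ x, W x * u.1 x * conj (v.1 x) := by
  set T := (firstOrderEquiv h).symm
  set T' := (firstOrderEquiv h').symm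
  have hm : ∀ u : sobolevPairs, u.1.1 ∈ (potentialForm W).dom := fun u => fst_mem_potentialDom hW u.2
  let e : sobolevPairs →ₗ[ℂ] (potentialForm W).dom :=
    ((LinearMap.fst ℂ L2R L2R).comp sobolevPairs.subtype).codRestrict _ hm
  let F : L2R →ₗ⋆[ℂ] L2R →ₗ[ℂ] ℂ := LinearMap.mk₂'ₛₗ (starRingEnd ℂ) (RingHom.id ℂ)
    (fun q p => (potentialForm W).form (e (T p)) (e (T' q)))
    (fun q₁ q₂ p => by simp only [map_add])
    (fun c q p => by simp only [map_smul, LinearMap.map_smulₛₗ])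
    (fun q p₁ p₂ => by simp only [map_add, LinearMap.add_apply])
    (fun c q p => by simp only [map_smul, LinearMap.smul_apply, RingHom.id_apply])
  have hF : ∀ q p, F q p = ∫ x, W x * (T p).1.1 x * conj ((T' q).1.1 x) := fun q p => rfl
  have hle : ∀ q p, ‖F q p‖ ≤ (∫ x, |x| * ‖W x‖) * ‖q‖ * ‖p‖ := by
    intro q p
    have := norm_integral_potential_le hW h.le h'.le (T p).2 (T' q).2
    rw [firstOrder_firstOrderEquiv_symm, firstOrder_firstOrderEquiv_symm] at this
    rw [hF]
    linarith
  set B := F.mkContinuous₂ _ hle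
  set S' := InnerProductSpace.continuousLinearMapOfBilin B
  have hS' : ∀ q p, ⟪S' q, p⟫_ℂ = F q p := fun q p =>
    InnerProductSpace.continuousLinearMapOfBilin_apply B q p
  -- The Riesz operator `S'` stands in the antilinear slot, and the required identity has the
  -- operator in the other one.
  refine ⟨S'.adjoint, ?_, fun u hu v hv => ?_⟩
  · rw [LinearIsometryEquiv.norm_map]
    refine S'.opNorm_le_bound (integral_nonneg fun x => by positivity) fun q => ?_
    have h1 : ‖S' q‖ ^ 2 ≤ (∫ x, |x| * ‖W x‖) * ‖q‖ * ‖S' q‖ := by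
      have := hle q (S' q)
      rw [← hS', inner_self_eq_norm_sq_to_K] at this
      simpa using this
    rcases (norm_nonneg (S' q)).eq_or_lt with h0 | h0
    · rw [← h0]
      have : 0 ≤ ∫ x, |x| * ‖W x‖ := integral_nonneg fun x => by positivity
      positivity
    · exact le_of_mul_le_mul_right (by rwa [← sq]) h0
  · rw [ContinuousLinearMap.adjoint_inner_right, hS', hF]
    have e1 : T (firstOrder α β u) = ⟨u, hu⟩ := by
      rw [← firstOrderEquiv_apply h ⟨u, hu⟩, ContinuousLinearEquiv.symm_apply_apply]
    have e2 : T' (firstOrder α' β' v) = ⟨v, hv⟩ := by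
      rw [← firstOrderEquiv_apply h' ⟨v, hv⟩, ContinuousLinearEquiv.symm_apply_apply]
    rw [e1, e2]

/-! ### The perturbed form on pairs -/

/-- The form of `H^D ∔ W` in terms of the pairs `(ψ, ψ')`. -/
def pairForm (W : L1R) (u v : L2R × L2R) : ℂ :=
  ⟪v.2, u.2⟫_ℂ + Complex.I * ⟪v.1, signMul u.1⟫_ℂ + ∫ x, W x * u.1 x * conj (v.1 x)

theorem inner_signMul_eq (u v : L2R) :
    ⟪v, signMul u⟫_ℂ = (∫ x in Set.Ioi 0, u x * conj (v x)) - ∫ x in Set.Iio 0, u x * conj (v x) := by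
  have hint := integrable_mul_conj u v
  rw [L2R.inner_eq, ← integral_indicator measurableSet_Ioi, ← integral_indicator measurableSet_Iio,
    ← integral_sub (hint.indicator measurableSet_Ioi) (hint.indicator measurableSet_Iio)]
  refine integral_congr_ae ?_
  filter_upwards [coeFn_signMul u, ae_ne_zero] with x h1 h2
  rw [h1]
  rcases lt_or_gt_of_ne h2 with h | h
  · simp [Real.sign_of_neg h, Set.indicator, h, h.not_gt]
  · simp [Real.sign_of_pos h, Set.indicator, h, h.not_gt]

theorem perturbedForm_apply {u v : L2R × L2R} (hu : u ∈ sobolevPairs) (hv : v ∈ sobolevPairs)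
    (hu' : u.1 ∈ (perturbedForm W).dom) (hv' : v.1 ∈ (perturbedForm W).dom) :
    (perturbedForm W).form ⟨u.1, hu'⟩ ⟨v.1, hv'⟩ = pairForm W u v := by
  have h1 : (perturbedForm W).form ⟨u.1, hu'⟩ ⟨v.1, hv'⟩
      = ((∫ x in Set.univ, W12zero.deriv ⟨u.1, hu'.1⟩ x * conj (W12zero.deriv ⟨v.1, hv'.1⟩ x))
        + Complex.I * (∫ x in Set.Ioi 0, u.1 x * conj (v.1 x))
        - Complex.I * (∫ x in Set.Iio 0, u.1 x * conj (v.1 x)))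
        + ∫ x, W x * u.1 x * conj (v.1 x) := rfl
  have e1 : W12zero.deriv ⟨u.1, hu'.1⟩ = u.2 := W12zero.deriv_eq hu _
  have e2 : W12zero.deriv ⟨v.1, hv'.1⟩ = v.2 := W12zero.deriv_eq hv _
  rw [h1, e1, e2, setIntegral_univ, pairForm, inner_signMul_eq, L2R.inner_eq]
  ring

/-- By the pointwise bound the potential form is defined on all of `W_0^{1,2}`, so the intersection
of form domains is harmless and `v` ranges over all Sobolev pairs. -/
theorem mem_operatorGraph_iff (hW : Integrable fun x : ℝ => |x| * ‖W x‖) {p : L2R × L2R} :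
    p ∈ (perturbedForm W).operatorGraph ↔ ∃ u ∈ sobolevPairs, u.1 = p.1 ∧
      ∀ v ∈ sobolevPairs, pairForm W u v = ⟪v.1, p.2⟫_ℂ := by
  constructor
  · rintro ⟨h, h'⟩
    have hu := W12zero.pair_mem ⟨p.1, h.1⟩
    refine ⟨_, hu, rfl, fun v hv => ?_⟩
    rw [← h' ⟨v.1, fst_mem_perturbedForm_dom hW hv⟩,
      ← perturbedForm_apply hu hv h (fst_mem_perturbedForm_dom hW hv)]
  · rintro ⟨u, hu, e, h⟩
    obtain ⟨p1, p2⟩ := p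
    obtain rfl : u.1 = p1 := e
    have hd := fst_mem_perturbedForm_dom hW hu
    refine ⟨hd, ?_⟩
    rintro ⟨φ, hφ⟩
    have hv := W12zero.pair_mem ⟨φ, hφ.1⟩
    have h1 := h _ hv
    rw [← perturbedForm_apply hu hv hd hφ] at h1
    exact h1

end Potential

/-! ### The resolvent set of an operator given by its graph -/

theorem mem_opResolventSet_toLinearPMap_iff {H : Type*} [NormedAddCommGroup H]
    [InnerProductSpace ℂ H] {g : Submodule ℂ (H × H)} (hg : ∀ p ∈ g, p.1 = 0 → p.2 = 0) {z : ℂ} :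
    z ∈ opResolventSet g.toLinearPMap ↔ ∃ R : H →L[ℂ] H,
      (∀ f, (R f, f + z • R f) ∈ g) ∧ ∀ p ∈ g, R (p.2 - z • p.1) = p.1 := by
  have happ : ∀ p ∈ g, ∀ h : p.1 ∈ g.toLinearPMap.domain, g.toLinearPMap ⟨p.1, h⟩ = p.2 := by
    intro p hp h
    have h1 := Submodule.mem_graph_toLinearPMap hg ⟨p.1, h⟩
    exact sub_eq_zero.1 (hg _ (g.sub_mem h1 hp) (by simp))
  constructor
  · rintro ⟨R, h1, h2⟩
    refine ⟨R, fun f => ?_, fun p hp => ?_⟩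
    · obtain ⟨h, e⟩ := h1 f
      have := Submodule.mem_graph_toLinearPMap hg ⟨R f, h⟩
      rw [← sub_eq_iff_eq_add.1 e]
      exact this
    · have h : p.1 ∈ g.toLinearPMap.domain := ⟨p, hp, rfl⟩
      have := h2 ⟨p.1, h⟩
      rwa [happ p hp h] at this
  · rintro ⟨R, h1, h2⟩
    have hd : ∀ f, R f ∈ g.toLinearPMap.domain := fun f => ⟨_, h1 f, rfl⟩
    refine ⟨R, fun f => ⟨hd f, ?_⟩, fun ψ => ?_⟩
    · have : g.toLinearPMap ⟨R f, hd f⟩ = f + z • R f := happ _ (h1 f) (hd f)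
      rw [this, add_sub_cancel_right]
    · exact h2 _ (Submodule.mem_graph_toLinearPMap hg ψ)

/-! ### The resolvent set of the perturbed operator -/

theorem exists_sq_eq_im_pos {μ : ℂ} (h : ¬(0 ≤ μ.re ∧ μ.im = 0)) : ∃ k : ℂ, k ^ 2 = μ ∧ 0 < k.im := by
  obtain ⟨k, hk⟩ := IsAlgClosed.exists_pow_nat_eq μ (n := 2) two_pos
  rcases lt_trichotomy k.im 0 with h0 | h0 | h0
  · exact ⟨-k, by rw [neg_sq, hk], by simpa using h0⟩
  · refine absurd ?_ h
    rw [← hk, sq]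
    simp only [Complex.mul_re, Complex.mul_im, h0]
    constructor
    · nlinarith [mul_self_nonneg k.re]
    · ring
  · exact ⟨k, hk, h0⟩

/-- The set `[0, ∞) + i {-1, 1}`. -/
def halfLines : Set ℂ := {z : ℂ | 0 ≤ z.re ∧ (z.im = -1 ∨ z.im = 1)}

/-- The square roots `k` of `z - i` and `l` of `z + i` satisfy `α + β = k` and `β - α = l`. Thus
`|Im α| < Im β` says exactly that both lie in the open upper half-plane. -/
theorem exists_factor {z : ℂ} (hz : z ∉ halfLines) :
    ∃ α β : ℂ, |α.im| < β.im ∧ α ^ 2 + β ^ 2 = z ∧ 2 * α * β = -Complex.I := by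
  obtain ⟨k, hk, hk0⟩ := exists_sq_eq_im_pos (μ := z - Complex.I) fun h =>
    hz ⟨by simpa using h.1, Or.inr (by simpa [sub_eq_zero] using h.2)⟩
  obtain ⟨l, hl, hl0⟩ := exists_sq_eq_im_pos (μ := z + Complex.I) fun h =>
    hz ⟨by simpa using h.1, Or.inl (by simpa [add_eq_zero_iff_eq_neg] using h.2)⟩
  refine ⟨(k - l) / 2, (k + l) / 2, ?_, ?_, ?_⟩
  · have e1 : ((k - l) / 2).im = (k.im - l.im) / 2 := by
      rw [show (2 : ℂ) = ((2 : ℝ) : ℂ) by simp, Complex.div_ofReal_im, Complex.sub_im]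
    have e2 : ((k + l) / 2).im = (k.im + l.im) / 2 := by
      rw [show (2 : ℂ) = ((2 : ℝ) : ℂ) by simp, Complex.div_ofReal_im, Complex.add_im]
    rw [e1, e2, abs_lt]
    constructor <;> linarith
  · linear_combination (hk + hl) / 2
  · linear_combination (hk - hl) / 2

/-- The weak equation reads `(L' v, (1 + S) L u) = (v, η - z u)`. Since `L'` is onto, it is
equivalent to `(1 + S) L u = J* (η - z u)` with `J = L'⁻¹` followed by the inclusion in `L²`. So `M
= (1 + S)⁻¹ J*`. The equivalence yields existence and uniqueness for the resolvent, and also an a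
priori bound on `L u`. -/
theorem exists_solution_operator {W : L1R} (hW : Integrable fun x : ℝ => |x| * ‖W x‖)
    (hW1 : ∫ x, |x| * ‖W x‖ < 1) {z : ℂ} (hz : z ∉ halfLines) :
    ∃ α β : ℂ, |α.im| < β.im ∧ ∃ M : L2R →L[ℂ] L2R, ∀ u ∈ sobolevPairs, ∀ η : L2R,
      (∀ v ∈ sobolevPairs, pairForm W u v = ⟪v.1, η⟫_ℂ) ↔
        firstOrder α β u = M (η - z • u.1) := by
  obtain ⟨α, β, h, e1, e2⟩ := exists_factor hz
  have h' : |(-conj α).im| < (-conj β).im := by simpa using h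
  obtain ⟨S, hS, hS'⟩ := exists_potentialOp hW h h'
  obtain ⟨A, hA⟩ := isUnit_one_sub_of_norm_lt_one (x := -S) (by rw [norm_neg]; exact hS.trans_lt hW1)
  rw [sub_neg_eq_add] at hA
  set T' := (firstOrderEquiv h').symm
  let J : L2R →L[ℂ] L2R :=
    (ContinuousLinearMap.fst ℂ L2R L2R).comp (sobolevPairs.subtypeL.comp (T' : L2R →L[ℂ] sobolevPairs))
  have hJ : ∀ q, J q = (T' q).1.1 := fun q => rfl
  have hform : ∀ u ∈ sobolevPairs, ∀ v ∈ sobolevPairs,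
      pairForm W u v = z * ⟪v.1, u.1⟫_ℂ
        + ⟪firstOrder (-conj α) (-conj β) v, (A : L2R →L[ℂ] L2R) (firstOrder α β u)⟫_ℂ := by
    intro u hu v hv
    rw [hA, add_apply, one_apply_eq_self, inner_add_right,
      hS' u hu v hv, inner_firstOrder hu hv, e1, e2, pairForm]
    ring
  refine ⟨α, β, h, (↑A⁻¹ : L2R →L[ℂ] L2R).comp J.adjoint, fun u hu η => ?_⟩
  have hiff : firstOrder α β u = ((↑A⁻¹ : L2R →L[ℂ] L2R).comp J.adjoint) (η - z • u.1) ↔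
      (A : L2R →L[ℂ] L2R) (firstOrder α β u) = J.adjoint (η - z • u.1) := by
    rw [ContinuousLinearMap.comp_apply]
    constructor
    · intro e
      rw [e, ← mul_apply_eq_comp, A.mul_inv, one_apply_eq_self]
    · intro e
      rw [← e, ← mul_apply_eq_comp, A.inv_mul, one_apply_eq_self]
  rw [hiff, ext_iff_inner_left ℂ]
  simp only [ContinuousLinearMap.adjoint_inner_right]
  constructor
  · intro hv q
    have h1 := hv _ (T' q).2
    rw [hform u hu _ (T' q).2, firstOrder_firstOrderEquiv_symm] at h1
    rw [inner_sub_right, inner_smul_right, hJ, ← h1]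
    ring
  · intro hq v hv
    have h1 := hq (firstOrder (-conj α) (-conj β) v)
    have e : T' (firstOrder (-conj α) (-conj β) v) = ⟨v, hv⟩ := by
      rw [← firstOrderEquiv_apply h' ⟨v, hv⟩, ContinuousLinearEquiv.symm_apply_apply]
    rw [hJ, e, inner_sub_right, inner_smul_right] at h1
    rw [hform u hu v hv, h1]
    ring

theorem mem_opResolventSet_of_notMem {W : L1R} (hW : Integrable fun x : ℝ => |x| * ‖W x‖)
    (hW1 : ∫ x, |x| * ‖W x‖ < 1) {z : ℂ} (hz : z ∉ halfLines) :
    z ∈ opResolventSet (dirichletPerturbed W) := by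
  obtain ⟨α, β, h, M, hM⟩ := exists_solution_operator hW hW1 hz
  set T := (firstOrderEquiv h).symm
  refine (mem_opResolventSet_toLinearPMap_iff
    ((perturbedForm W).operatorGraph_functional (perturbedForm_dense W))).2
    ⟨(ContinuousLinearMap.fst ℂ L2R L2R).comp (sobolevPairs.subtypeL.comp
      ((T : L2R →L[ℂ] sobolevPairs).comp M)), fun f => ?_, fun p hp => ?_⟩
  · refine (mem_operatorGraph_iff hW).2 ⟨T (M f), (T (M f)).2, rfl, ?_⟩
    refine (hM _ (T (M f)).2 _).2 ?_
    rw [firstOrder_firstOrderEquiv_symm]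
    congr 1
    exact (add_sub_cancel_right f _).symm
  · obtain ⟨u, hu, e, hv⟩ := (mem_operatorGraph_iff hW).1 hp
    have h1 := (hM u hu _).1 hv
    rw [e] at h1
    have h2 : T (M (p.2 - z • p.1)) = ⟨u, hu⟩ := by
      rw [← h1, ← firstOrderEquiv_apply h ⟨u, hu⟩, ContinuousLinearEquiv.symm_apply_apply]
    have h3 : (T (M (p.2 - z • p.1))).1.1 = p.1 := by rw [h2, ← e]
    exact h3

/-! ### Singular sequences -/

/-- The modulation `e^{ikx} f(x)` of a function. -/
def modulate (k : ℝ) (f : ℝ → ℂ) (x : ℝ) : ℂ := Complex.exp (Complex.I * k * x) * f x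

theorem norm_modulate (k : ℝ) (f : ℝ → ℂ) (x : ℝ) : ‖modulate k f x‖ = ‖f x‖ := by
  rw [modulate, norm_mul, Complex.norm_exp]
  simp

theorem hasDerivAt_modulate (k : ℝ) {f : ℝ → ℂ} {f' : ℂ} {x : ℝ} (h : HasDerivAt f f' x) :
    HasDerivAt (modulate k f)
      (Complex.exp (Complex.I * k * x) * (f' + Complex.I * k * f x)) x := by
  have h1 := ((Complex.ofRealCLM.hasDerivAt (x := x)).const_mul (Complex.I * k)).cexp
  refine (h1.mul h).congr_deriv ?_
  simp only [Complex.ofRealCLM_apply, Complex.ofReal_one]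
  ring

theorem IsTestFun.modulate {f : ℝ → ℂ} (h : IsTestFun f) (k : ℝ) : IsTestFun (modulate k f) :=
  h.mul_left fun _ _ => (contDiffAt_const.mul Complex.ofRealCLM.contDiff.contDiffAt).cexp

theorem IsTestFun.deriv_modulate {f : ℝ → ℂ} (h : IsTestFun f) (k : ℝ) :
    _root_.deriv (_root_.modulate k f)
      = _root_.modulate k fun x => _root_.deriv f x + Complex.I * k * f x :=
  funext fun x => (hasDerivAt_modulate k (h.hasDerivAt x)).deriv

theorem IsTestFun.add {φ χ : ℝ → ℂ} (h : IsTestFun φ) (h' : IsTestFun χ) :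
    IsTestFun fun x => φ x + χ x :=
  ⟨h.1.add h'.1, h.2.1.add h'.2.1, (tsupport_add _ _).trans (Set.union_subset h.2.2 h'.2.2)⟩

/-- The term `k² f` cancels. Every remaining term contains a derivative of `f`, hence is small for a
slowly varying envelope. -/
theorem IsTestFun.deriv_deriv_modulate {f : ℝ → ℂ} (h : IsTestFun f) (k x : ℝ) :
    _root_.deriv (_root_.deriv (_root_.modulate k f)) x + k ^ 2 * _root_.modulate k f x
      = _root_.modulate k
        (fun x => _root_.deriv (_root_.deriv f) x + 2 * Complex.I * k * _root_.deriv f x) x := by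
  have h1 := h.deriv.add (h.const_mul (Complex.I * k))
  rw [h.deriv_modulate, h1.deriv_modulate]
  have h2 : _root_.deriv (fun x => _root_.deriv f x + Complex.I * k * f x) x
      = _root_.deriv (_root_.deriv f) x + Complex.I * k * _root_.deriv f x :=
    ((h.deriv.hasDerivAt x).add ((h.hasDerivAt x).const_mul (Complex.I * k))).deriv
  simp only [_root_.modulate, h2]
  linear_combination (k ^ 2 * Complex.exp (Complex.I * k * x) * f x) * Complex.I_sq

theorem norm_toLp_modulate_comp_mul_left {f : ℝ → ℂ} (h : IsTestFun f) (k : ℝ) {s : ℝ}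
    (hs : 0 < s) (h' : MemLp (modulate k fun x => f ((s ^ 2)⁻¹ * x)) 2 volume) :
    ‖h'.toLp _‖ = s * ‖h.memLp.toLp f‖ := by
  have h1 : ‖h'.toLp _‖ ^ 2 = (s * ‖h.memLp.toLp f‖) ^ 2 := by
    rw [mul_pow, norm_toLp_sq, norm_toLp_sq]
    simp only [norm_modulate]
    rw [Measure.integral_comp_mul_left (fun x => ‖f x‖ ^ 2), inv_inv, abs_of_pos (by positivity),
      smul_eq_mul]
  exact (pow_left_inj₀ (norm_nonneg _) (by positivity) two_ne_zero).1 h1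

/-- A second integration by parts puts both derivatives on `φ`, so `u` need not have a second
derivative. On the support of `φ` the sign is the constant `σ`. -/
theorem pairForm_pair {W : L1R} {u : L2R × L2R} (hu : u ∈ sobolevPairs) {φ : ℝ → ℂ}
    (h : IsTestFun φ) {σ : ℝ} (hσ : ∀ x, Real.sign x * φ x = σ * φ x) :
    pairForm W u h.pair = -⟪h.deriv.deriv.memLp.toLp _, u.1⟫_ℂ
      + Complex.I * σ * ⟪h.memLp.toLp φ, u.1⟫_ℂ + ∫ x, W x * u.1 x * conj (φ x) := by
  have h1 : ⟪h.pair.2, u.2⟫_ℂ = -⟪h.deriv.deriv.memLp.toLp _, u.1⟫_ℂ := by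
    have := inner_snd_fst h.deriv.pair_mem_sobolevPairs (sobolevPairs_le hu)
    rw [show h.deriv.deriv.memLp.toLp _ = h.deriv.pair.2 from rfl, this, neg_neg]
    rfl
  have h2 : signMul (h.memLp.toLp φ) = (σ : ℂ) • h.memLp.toLp φ := by
    apply Lp.ext
    filter_upwards [coeFn_signMul (h.memLp.toLp φ), h.memLp.coeFn_toLp,
      Lp.coeFn_smul (σ : ℂ) (h.memLp.toLp φ)] with x e1 e2 e3
    rw [e1, e3, Pi.smul_apply, e2, hσ, smul_eq_mul]
  have h3 : ∫ x, W x * u.1 x * conj (h.pair.1 x) = ∫ x, W x * u.1 x * conj (φ x) := by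
    refine integral_congr_ae ?_
    filter_upwards [h.memLp.coeFn_toLp] with x hx
    rw [IsTestFun.pair, hx]
  rw [pairForm, h1, h3, ← inner_signMul_left, show h.pair.1 = h.memLp.toLp φ from rfl, h2,
    inner_smul_left, Complex.conj_ofReal]
  ring

/-- Only the supremum of `φ` enters, and it is unchanged when the envelope of a wave packet is
stretched. -/
theorem norm_integral_potential_mul_le {W : L1R} (hW : Integrable fun x : ℝ => |x| * ‖W x‖)
    {α β : ℂ} (h : |α.im| ≤ β.im) {u : L2R × L2R} (hu : u ∈ sobolevPairs) {φ : ℝ → ℂ} {C : ℝ}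
    (hφ : ∀ x, ‖φ x‖ ≤ C) :
    ‖∫ x, W x * u.1 x * conj (φ x)‖ ≤ ‖firstOrder α β u‖ * (C * ∫ x, (1 + |x|) * ‖W x‖) := by
  have hi : Integrable fun x : ℝ => (1 + |x|) * ‖W x‖ := by
    simp only [add_mul, one_mul]
    exact (L1.integrable_coeFn W).norm.add hW
  rw [← integral_const_mul, ← integral_const_mul]
  refine norm_integral_le_of_norm_le ((hi.const_mul _).const_mul _) ?_
  filter_upwards [ae_norm_le h hu] with x h1
  have h2 : √|x| ≤ 1 + |x| := by
    rw [Real.sqrt_le_left (by positivity)]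
    nlinarith [abs_nonneg x]
  rw [norm_mul, norm_mul, RCLike.norm_conj]
  calc ‖W x‖ * ‖u.1 x‖ * ‖φ x‖
      ≤ ‖W x‖ * ((1 + |x|) * ‖firstOrder α β u‖) * C := by
        gcongr
        · exact h1.trans (by gcongr)
        · exact hφ x
    _ = _ := by ring

theorem notMem_opResolventSet_of_mem {W : L1R} (hW : Integrable fun x : ℝ => |x| * ‖W x‖)
    (hW1 : ∫ x, |x| * ‖W x‖ < 1) {z : ℂ} (hz : z ∈ halfLines) :
    z ∉ opResolventSet (dirichletPerturbed W) := by
  intro hres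
  obtain ⟨R, hR, -⟩ := (mem_opResolventSet_toLinearPMap_iff
    ((perturbedForm W).operatorGraph_functional (perturbedForm_dense W))).1 hres
  -- The point `-1` lies off the half-lines and serves as a reference: its solution operator bounds
  -- `L u` in terms of `f` and `R f`, although `z` itself admits no factorisation of this kind.
  obtain ⟨α, β, h, M, hM⟩ := exists_solution_operator hW hW1 (z := -1)
    (fun h => by have := h.1; norm_num at this)
  obtain ⟨ρ, hρ, hs, hi⟩ := exists_testFun_integral_eq_one (σ := z.im) hz.2.symm
  obtain ⟨C, hC⟩ := hρ.1.continuous.bounded_above_of_compact_support hρ.2.1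
  set k := √z.re
  have hk : k ^ 2 = z.re := Real.sq_sqrt hz.1
  have hzk : z = k ^ 2 + Complex.I * z.im := by
    apply Complex.ext <;> simp [← Complex.ofReal_pow, hk]
  set N := ‖hρ.memLp.toLp ρ‖
  have hN : 0 < N := by
    refine (norm_nonneg _).lt_of_ne fun h0 => ?_
    have h1 : hρ.memLp.toLp ρ = 0 := norm_eq_zero.1 h0.symm
    have h2 : ∫ x, ρ x = 0 := integral_eq_zero_of_ae (by
      filter_upwards [hρ.memLp.coeFn_toLp, Lp.coeFn_zero ℂ 2 (volume : Measure ℝ)] with x e1 e2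
      rw [← e1, h1, e2])
    rw [hi] at h2
    exact one_ne_zero h2
  set A := ‖hρ.deriv.deriv.memLp.toLp _‖
  set B := ‖hρ.deriv.memLp.toLp _‖
  have hk0 : 0 ≤ k := Real.sqrt_nonneg _
  set P := ‖R‖ * N * (A + 2 * k * B)
  set Q := ‖M‖ * (1 + ‖z‖ * ‖R‖ + ‖R‖) * N * (C * ∫ x, (1 + |x|) * ‖W x‖)
  have hC0 : 0 ≤ C := (norm_nonneg _).trans (hC 0)
  have hI0 : 0 ≤ ∫ x, (1 + |x|) * ‖W x‖ := integral_nonneg fun x => by positivity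
  have hP : 0 ≤ P := by positivity
  have hQ : 0 ≤ Q := by positivity
  -- With `φ` the packet of width `s²` and `u = R φ`, the resolvent equation tested on `φ` reads
  -- `‖φ‖² = -(u, φ'' + k² φ) + ∫ W u conj φ`. Here `‖φ‖ = s N` and `‖u‖ ≤ ‖R‖ s N`, while `‖φ'' +
  -- k² φ‖` is of order `1/s`. The first term is therefore bounded and the second is of order `s`.
  have key : ∀ s : ℝ, 1 ≤ s → (s * N) ^ 2 ≤ P + Q * s := by
    intro s hs1
    have hs0 : 0 < s := by linarith
    set c := (s ^ 2)⁻¹ with hc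
    have hc0 : 0 < c := by positivity
    have hf := hρ.comp_mul_left hc0.ne'
    have hd1 : deriv (fun x => ρ (c * x)) = fun x => (c : ℂ) * deriv ρ (c * x) := by
      funext x
      rw [deriv_comp_mul_left]; simp
    have hd2 : deriv (deriv fun x => ρ (c * x)) = fun x => (c : ℂ) ^ 2 * deriv (deriv ρ) (c * x) := by
      funext x
      rw [hd1, deriv_const_mul_field, deriv_comp_mul_left]; simp; ring
    have hφ := hf.modulate k
    set φ := modulate k fun x => ρ (c * x) with hφdef
    have hsign : ∀ x, Real.sign x * φ x = z.im * φ x := by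
      intro x
      by_cases hx : ρ (c * x) = 0
      · simp [hφdef, modulate, hx]
      · have h1 : 0 < z.im * (c * x) := not_le.1 fun h0 => hx (hs _ h0)
        congr 2
        rcases hz.2 with h0 | h0 <;> rw [h0] at h1 ⊢
        · exact Real.sign_of_neg (by nlinarith)
        · exact Real.sign_of_pos (by rw [one_mul] at h1; exact pos_of_mul_pos_right h1 hc0.le)
    set f := hφ.memLp.toLp φ with hfdef
    have hnf : ‖f‖ = s * N := norm_toLp_modulate_comp_mul_left hρ k hs0 _
    obtain ⟨u, hu, e, hv⟩ := (mem_operatorGraph_iff hW).1 (hR f)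
    simp only at e hv
    have hform := hv _ hφ.pair_mem_sobolevPairs
    rw [pairForm_pair hu hφ hsign, show hφ.pair.1 = f from rfl, inner_add_right,
      inner_smul_right, ← e, inner_self_eq_norm_sq_to_K] at hform
    have hD : ‖firstOrder α β u‖ ≤ ‖M‖ * (1 + ‖z‖ * ‖R‖ + ‖R‖) * (s * N) := by
      have h1 := (hM u hu _).1 hv
      rw [h1, mul_assoc]
      refine (M.le_opNorm _).trans (mul_le_mul_of_nonneg_left ?_ (norm_nonneg _))
      rw [e, neg_one_smul, sub_neg_eq_add]
      refine (norm_add_le _ _).trans ?_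
      refine (add_le_add_left (norm_add_le _ _) _).trans ?_
      rw [norm_smul, ← hnf]
      have := R.le_opNorm f
      have h2 := mul_le_mul_of_nonneg_left this (norm_nonneg z)
      linarith
    have hw := norm_integral_potential_mul_le hW h.le hu (φ := φ) (C := C) fun x => by
      rw [hφdef, norm_modulate]; exact hC _
    have hq1 := (hρ.deriv.deriv.comp_mul_left hc0.ne').modulate k
    have hq2 := (hρ.deriv.comp_mul_left hc0.ne').modulate k
    have hg : hφ.deriv.deriv.memLp.toLp _ + (k : ℂ) ^ 2 • f
        = (c : ℂ) ^ 2 • hq1.memLp.toLp _ + (2 * Complex.I * k * c) • hq2.memLp.toLp _ := by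
      rw [hfdef, ← MemLp.toLp_const_smul, ← MemLp.toLp_const_smul, ← MemLp.toLp_const_smul,
        ← MemLp.toLp_add, ← MemLp.toLp_add]
      congr 1
      funext x
      have := hf.deriv_deriv_modulate k x
      simp only [Pi.add_apply, Pi.smul_apply, smul_eq_mul]
      rw [hφdef, this, hd2, hd1]
      simp only [modulate]
      ring
    have hg2 : ‖hφ.deriv.deriv.memLp.toLp _ + (k : ℂ) ^ 2 • f‖ * s ≤ A + 2 * k * B := by
      have n1 : ‖hq1.memLp.toLp _‖ = s * A := norm_toLp_modulate_comp_mul_left hρ.deriv.deriv k hs0 _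
      have n2 : ‖hq2.memLp.toLp _‖ = s * B := norm_toLp_modulate_comp_mul_left hρ.deriv k hs0 _
      have hcs : c * s ^ 2 = 1 := by rw [hc]; field_simp
      have hc1 : c ≤ 1 := by
        rw [hc]; exact inv_le_one_of_one_le₀ (one_le_pow₀ hs1)
      rw [hg]
      refine (mul_le_mul_of_nonneg_right (norm_add_le _ _) hs0.le).trans ?_
      rw [norm_smul, norm_smul, n1, n2]
      have : ‖(c : ℂ) ^ 2‖ = c ^ 2 := by simp
      rw [this]
      have : ‖2 * Complex.I * (k : ℂ) * (c : ℂ)‖ = 2 * k * c := by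
        simp [abs_of_nonneg hk0, abs_of_pos hc0]
      rw [this]
      have hA : 0 ≤ A := norm_nonneg _
      calc (c ^ 2 * (s * A) + 2 * k * c * (s * B)) * s
          = c * (c * s ^ 2) * A + 2 * k * (c * s ^ 2) * B := by ring
        _ = c * A + 2 * k * B := by rw [hcs]; ring
        _ ≤ A + 2 * k * B := by nlinarith
    have hfin : ((‖f‖ : ℂ)) ^ 2 = -⟪hφ.deriv.deriv.memLp.toLp _ + (k : ℂ) ^ 2 • f, u.1⟫_ℂ
        + ∫ x, W x * u.1 x * conj (φ x) := by
      rw [inner_add_left, inner_smul_left, map_pow, Complex.conj_ofReal]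
      have hz2 := congrArg (· * ⟪f, u.1⟫_ℂ) hzk
      rw [hz2] at hform
      have hform : _ = ((‖f‖ : ℝ) : ℂ) ^ 2 + _ := hform
      linear_combination -hform
    have hu1 : ‖u.1‖ ≤ ‖R‖ * (s * N) := by
      rw [e, ← hnf]; exact R.le_opNorm f
    have hn := congrArg norm hfin
    rw [norm_pow, Complex.norm_real, norm_norm, hnf] at hn
    rw [hn]
    refine (norm_add_le _ _).trans (add_le_add ?_ ?_)
    · rw [norm_neg]
      refine (norm_inner_le_norm _ _).trans ?_
      refine (mul_le_mul_of_nonneg_left hu1 (norm_nonneg _)).trans ?_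
      have := mul_le_mul_of_nonneg_left hg2 (by positivity : 0 ≤ ‖R‖ * N)
      linarith
    · refine hw.trans ((mul_le_mul_of_nonneg_right hD (by positivity)).trans (le_of_eq ?_))
      ring
  -- This choice gives `(s N)² = s (N² + P + Q)`, which exceeds `P + Q s` because `s ≥ 1` and `N >
  -- 0`.
  set s := 1 + (P + Q) / N ^ 2
  have hs1 : 1 ≤ s := le_add_of_nonneg_right (by positivity)
  have h1 := key s hs1
  have h2 : s * N ^ 2 = N ^ 2 + (P + Q) := by
    simp only [s]; field_simp
  have h3 : (s * N) ^ 2 = s * (N ^ 2 + (P + Q)) := by rw [← h2]; ring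
  rw [h3] at h1
  nlinarith [sq_nonneg N, pow_pos hN 2]

/-! ### The Dirichlet operator is associated with its form -/

theorem pairForm_zero (u v : L2R × L2R) :
    pairForm 0 u v = ⟪v.2, u.2⟫_ℂ + Complex.I * ⟪v.1, signMul u.1⟫_ℂ := by
  have : ∫ x, (0 : L1R) x * u.1 x * conj (v.1 x) = 0 := integral_eq_zero_of_ae (by
    filter_upwards [Lp.coeFn_zero ℂ 1 (volume : Measure ℝ)] with x hx
    rw [hx]; simp)
  rw [pairForm, this, add_zero]

theorem integrable_abs_mul_norm_zero : Integrable fun x : ℝ => |x| * ‖(0 : L1R) x‖ := by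
  refine (integrable_zero ℝ ℝ volume).congr ?_
  filter_upwards [Lp.coeFn_zero ℂ 1 (volume : Measure ℝ)] with x hx
  rw [hx]; simp

/-- The form identity against test functions says precisely that `u'` has the weak derivative `i sgn
u - η`, which supplies the `W^{2,2}` regularity. The converse is integration by parts. -/
theorem dirichletOp_eq : dirichletOp = dirichletPerturbed 0 := by
  refine LinearPMap.eq_of_eq_graph ?_
  rw [dirichletPerturbed, SesqForm.operator, Submodule.toLinearPMap_graph_eq _
    ((perturbedForm 0).operatorGraph_functional (perturbedForm_dense 0))]
  ext p
  rw [mem_operatorGraph_iff integrable_abs_mul_norm_zero, LinearPMap.mem_graph_iff]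
  simp only [pairForm_zero]
  constructor
  · rintro ⟨ψ, hψ, hη⟩
    refine ⟨_, ψ.2.2.2, hψ, fun v hv => ?_⟩
    have h1 := inner_snd_fst hv (weakDeriv_mem ψ.2.1.2)
    have h2 : -weakDeriv ⟨weakDeriv ⟨ψ, ψ.2.1.1⟩, ψ.2.1.2⟩ + Complex.I • signMul (ψ : L2R) = p.2 := hη
    rw [← h2, inner_add_right, inner_neg_right, inner_smul_right]
    exact congrArg (· + _) h1
  · rintro ⟨u, hu, e, hv⟩
    have hg : (u.2, Complex.I • signMul u.1 - p.2) ∈ weakDerivGraph := by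
      refine mem_weakDerivGraph_iff.2 fun φ h => ?_
      have := hv _ h.pair_mem_sobolevPairs
      simp only [inner_sub_right, inner_smul_right]
      linear_combination this
    have hu1 : u.1 ∈ W12 := mem_W12_of_mem (sobolevPairs_le hu)
    have hd : weakDeriv ⟨u.1, hu1⟩ = u.2 := weakDeriv_eq (sobolevPairs_le hu) hu1
    have hu2 : weakDeriv ⟨u.1, hu1⟩ ∈ W12 := by rw [hd]; exact mem_W12_of_mem hg
    refine ⟨⟨u.1, ⟨hu1, hu2⟩, mem_W12zero_of_mem hu⟩, e, ?_⟩
    have h3 : weakDeriv ⟨weakDeriv ⟨u.1, hu1⟩, hu2⟩ = Complex.I • signMul u.1 - p.2 := by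
      have h : (weakDeriv ⟨u.1, hu1⟩, Complex.I • signMul u.1 - p.2) ∈ weakDerivGraph := by
        rw [hd]; exact hg
      exact weakDeriv_eq h hu2
    have h4 : -weakDeriv ⟨weakDeriv ⟨u.1, hu1⟩, hu2⟩ + Complex.I • signMul u.1 = p.2 := by
      rw [h3]; abel
    exact h4

/-! ### The spectrum under the smallness condition, and the theorem. -/

theorem opSpectrum_dirichletPerturbed {W : L1R} (hW : Integrable fun x : ℝ => |x| * ‖W x‖)
    (hW1 : ∫ x, |x| * ‖W x‖ < 1) : opSpectrum (dirichletPerturbed W) = halfLines := by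
  ext z
  constructor
  · intro hz
    by_contra hne
    exact hz (mem_opResolventSet_of_notMem hW hW1 hne)
  · exact notMem_opResolventSet_of_mem hW hW1

end

theorem proposition9 (V : L1R)
    (hV : Integrable (fun x : ℝ => ((1 + x ^ 2 : ℝ) : ℂ) * V x) volume) :
    ∃ ε₀ : ℝ, 0 < ε₀ ∧ ∀ ε : ℝ, 0 < ε → ε < ε₀ →
      opSpectrum (dirichletPerturbed (ε • V)) = opSpectrum dirichletOp ∧
      opSpectrum dirichletOp = {z : ℂ | 0 ≤ z.re ∧ (z.im = -1 ∨ z.im = 1)} := by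
  have h0 : opSpectrum dirichletOp = halfLines := by
    rw [dirichletOp_eq]
    refine opSpectrum_dirichletPerturbed integrable_abs_mul_norm_zero ?_
    refine lt_of_eq_of_lt (integral_eq_zero_of_ae ?_) one_pos
    filter_upwards [Lp.coeFn_zero ℂ 1 (volume : Measure ℝ)] with x hx
    rw [hx]; simp
  have hint : Integrable fun x : ℝ => |x| * ‖V x‖ := by
    refine hV.norm.mono' (continuous_abs.aestronglyMeasurable.mul
      (Lp.aestronglyMeasurable V).norm) (Filter.Eventually.of_forall fun x => ?_)
    rw [norm_mul, norm_mul, norm_norm, Complex.norm_real, Real.norm_eq_abs, Real.norm_eq_abs,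
      abs_abs, abs_of_pos (by positivity : 0 < 1 + x ^ 2)]
    refine mul_le_mul_of_nonneg_right ?_ (norm_nonneg _)
    -- The weight `1 + x²` dominates `|x|`.
    nlinarith [sq_abs x, sq_nonneg (|x| - 1), abs_nonneg x]
  have hm : 0 ≤ ∫ x, |x| * ‖V x‖ := integral_nonneg fun x => by positivity
  -- Any smaller `ε` gives `ε ∫ |x| |V| < 1`; the added `1` avoids dividing by zero when the moment
  -- vanishes.
  refine ⟨(1 + ∫ x, |x| * ‖V x‖)⁻¹, by positivity, fun ε hε hε' => ⟨?_, h0⟩⟩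
  have hae : (fun x => ε * (|x| * ‖V x‖)) =ᵐ[volume] fun x => |x| * ‖(ε • V) x‖ := by
    filter_upwards [Lp.coeFn_smul ε V] with x hx
    rw [hx, Pi.smul_apply, norm_smul, Real.norm_eq_abs, abs_of_pos hε]
    ring
  rw [h0]
  refine opSpectrum_dirichletPerturbed ((hint.const_mul ε).congr hae) ?_
  rw [← integral_congr_ae hae, integral_const_mul]
  have : ε * (1 + ∫ x, |x| * ‖V x‖) < 1 := by
    rwa [← lt_inv_mul_iff₀' (by positivity), mul_one]
  linarith
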